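/- **Theorem 3.1 (Probabilistic error analysis of CholeskyQR2).** Let $n\ge 1$, let $T\in\mathbb R^{m\times n}$ have rank $n$, and let $\|\cdot\|_2$ and $\|\cdot\|_F$ be the spectral and the Frobenius norm, $\|A\|_g$ the largest Euclidean norm of a column of $A$, and $\kappa_2(T)=\|T\|_2/\sigma_{\min}(T)$. Let ${\bf u}>0$ be the unit roundoff, let $\lambda>0$, and put $$P(\lambda)=1-2\exp\Bigl(-\frac{\lambda^2(1-{\bf u})^2}{2}\Bigr),\qquad Q(\lambda,N)=1-N\,(1-P(\lambda)).$$ *Algorithm and rounding model.* One run $[Q,V]=\mathrm{CholeskyQR}(T)$ computes $U=\mathrm{fl}(T^\top T)$, then the upper triangular Cholesky factor $V$ of $U$ (only the entries of $U$ on and above the diagonal are read), then $Q=\mathrm{fl}(TV^{-1})$ by substitution, row by row. CholeskyQR2 computes $[Q,V]=\mathrm{CholeskyQR}(T)$, $[Q_1,V_1]=\mathrm{CholeskyQR}(Q)$ and $V_2=\mathrm{fl}(V_1V)$. All sums are accumulated from left to right. Every elementary operation ($+,-,\times,/$ and $\sqrt{\ }$) is computed with its own relative error, $\mathrm{fl}(x\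 \mathrm{op}\ y)=(x\ \mathrm{op}\ y)(1+\delta)$ and $\mathrm{fl}(\sqrt x)=\sqrt x\,(1+\delta)$, and the errors $\delta$ of all operations are independent random variables of mean zero with $|\delta|\le{\bf u}$ almost surely. A run of CholeskyQR is completed if all computed radicands in its Cholesky factorization are positive. *Assumptions.* Suppose that $$\max(\lambda\sqrt m\,n{\bf u},\,mn{\bf u})\le\tfrac1{2200},\qquad \max(\lambda\sqrt{n+1}\,n{\bf u},\,(n+1)n{\bf u})\le\tfrac1{2200},\qquad Q(\lambda,mn^2)>0$$ (the other values of $Q$ below are then positive too). Put $p_1=\|T\|_g/\|T\|_2$, $p_2=\|Q\|_g/\|Q\|_2$ and $$\delta_i=8p_i\,\kappa_2(T)\sqrt{\lambda\bigl(\sqrt m\,n{\bf u}+\sqrt{n+1}\,n{\bf u}\bigr)}\qquad(i=1,2),$$ so that $p_2$ and $\delta_2$ are random, and suppose that $\delta_1\le1$. *Conclusion.* Then $\frac1{\sqrt n}\le p_1\le1$, and with probability at least $$\Bigl(Q(\lambda,mn^2)\,Q\bigl(\lambda,\tfrac{n^3}6+\tfrac{n^2}2+\tfrac n3\bigr)\,Q\bigl(\lambda,\tfrac{n(n+1)}2\bigr)\Bigr)^2\,Q(\lambda,n^3)$$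 the following holds: the first run of CholeskyQR is completed, $\frac1{\sqrt n}\le p_2\le1$, and, if $\delta_2\le1$, the second run is completed as well and $$\|Q_1^\top Q_1-I\|_F\le 6\lambda\,p_2^2\bigl(\sqrt m\,n{\bf u}+\sqrt{n+1}\,n{\bf u}\bigr),$$ $$\|Q_1V_2-T\|_F\le(1.2p_1+1.32p_2+1.32p_1p_2)\,\lambda\,n\sqrt n\,{\bf u}\,\|T\|_2 .$$ -/

import Mathlib

open MeasureTheory ProbabilityTheory

namespace CholQR

/-! ### Matrix norms, smallest singular value, condition number -/

section Norms

open scoped Matrix.Norms.L2Operator in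
/-- The spectral norm `‖A‖₂`. -/
noncomputable def specNorm {m n : ℕ} (A : Matrix (Fin m) (Fin n) ℝ) : ℝ := ‖A‖

open scoped Matrix.Norms.Frobenius in
/-- The Frobenius norm `‖A‖_F`. -/
noncomputable def frobNorm {m n : ℕ} (A : Matrix (Fin m) (Fin n) ℝ) : ℝ := ‖A‖

/-- The `g`-norm: the largest Euclidean norm of a column. -/
noncomputable def gNorm {m n : ℕ} (A : Matrix (Fin m) (Fin n) ℝ) : ℝ :=
  ⨆ j : Fin n, ‖WithLp.toLp 2 (fun i : Fin m => A i j)‖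

/-- The smallest of the `n` singular values of an `m × n` matrix (`n ≥ 1`). Mathlib lists the
singular values in decreasing order, starting with index `0`. -/
noncomputable def sigmaMin {m n : ℕ} (A : Matrix (Fin m) (Fin n) ℝ) : ℝ :=
  (Matrix.toEuclideanLin A).singularValues (n - 1)

/-- The condition number `κ₂(A) = σ_max(A) / σ_min(A)` of a matrix with full column rank. -/
noncomputable def kappa2 {m n : ℕ} (A : Matrix (Fin m) (Fin n) ℝ) : ℝ :=
  specNorm A / sigmaMin A

/-- The ratio `‖A‖_g / ‖A‖₂`. -/
noncomputable def gRatio {m n : ℕ} (A : Matrix (Fin m) (Fin n) ℝ) : ℝ :=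
  gNorm A / specNorm A

end Norms

/-! ### The probabilities `P(λ)` and `Q(λ, N)` -/

/-- `P(λ) = 1 - 2 exp(-λ² (1 - u)² / 2)`, where `u` is the unit roundoff. -/
noncomputable def probP (u lam : ℝ) : ℝ :=
  1 - 2 * Real.exp (-(lam ^ 2 * (1 - u) ^ 2 / 2))

/-- `Q(λ, N) = 1 - N (1 - P(λ))`. -/
noncomputable def probQ (u lam N : ℝ) : ℝ := 1 - N * (1 - probP u lam)

/-! ### Rounded kernels

Every elementary operation is computed with a relative error of its own:
`fl(x op y) = (x op y) (1 + δ)` for `op ∈ {+, -, *, /}` and `fl(√x) = √x (1 + δ)`.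
The relative errors are arguments of the kernels. -/

/-- Computed inner product `∑ x k * y k`, accumulated from left to right. `δ k` is the error of the
`k`-th multiplication, `η k` that of the addition of the `k`-th product. The accumulation starts
with the first product, so `η 0` is not used. -/
noncomputable def flDot : (k : ℕ) → (x y δ η : Fin k → ℝ) → ℝ
  | 0, _, _, _, _ => 0
  | 1, x, y, δ, _ => x 0 * y 0 * (1 + δ 0)
  | k + 2, x, y, δ, η =>
      (flDot (k + 1) (fun i => x i.castSucc) (fun i => y i.castSucc)
          (fun i => δ i.castSucc) (fun i => η i.castSucc)
        + x (Fin.last (k + 1)) * y (Fin.last (k + 1)) * (1 + δ (Fin.last (k + 1))))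
      * (1 + η (Fin.last (k + 1)))

/-- Computed value of `c - ∑ x k * y k`: the products are subtracted from `c` from left to right.
`δ k` is the error of the `k`-th multiplication, `η k` that of the `k`-th subtraction. -/
noncomputable def flSubDot (c : ℝ) : (k : ℕ) → (x y δ η : Fin k → ℝ) → ℝ
  | 0, _, _, _, _ => c
  | k + 1, x, y, δ, η =>
      (flSubDot c k (fun i => x i.castSucc) (fun i => y i.castSucc)
          (fun i => δ i.castSucc) (fun i => η i.castSucc)
        - x (Fin.last k) * y (Fin.last k) * (1 + δ (Fin.last k)))
      * (1 + η (Fin.last k))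

/-- Computed matrix product `A * B`, one inner product for each entry. -/
noncomputable def flMul {a b c : ℕ} (A : Matrix (Fin a) (Fin b) ℝ) (B : Matrix (Fin b) (Fin c) ℝ)
    (δ η : Fin a → Fin c → Fin b → ℝ) : Matrix (Fin a) (Fin c) ℝ :=
  Matrix.of fun i j => flDot b (fun k => A i k) (fun k => B k j) (δ i j) (η i j)

/-- The embedding of the indices below `i` into `Fin n`. -/
def below {n : ℕ} (i : Fin n) (k : Fin i.val) : Fin n := Fin.castLE i.isLt.le k

/-- Computed upper triangular Cholesky factor `V` of a symmetric matrix `U`, of which only the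
entries on and above the diagonal are read:
`V i j = (U i j - ∑ k < i, V k i * V k j) / V i i` for `i < j` and
`V j j = √(U j j - ∑ k < j, V k j ^ 2)`. The numerator and the radicand are computed by `flSubDot`;
`ε i j` is the error of the division, and `ε j j` that of the square root. -/
noncomputable def flChol {n : ℕ} (U : Matrix (Fin n) (Fin n) ℝ)
    (δ η : Fin n → Fin n → Fin n → ℝ) (ε : Fin n → Fin n → ℝ) (i j : Fin n) : ℝ :=
  if _h : j < i then 0
  else if _h' : i = j then
    Real.sqrt (flSubDot (U j j) i.val
      (fun k => flChol U δ η ε (below i k) i) (fun k => flChol U δ η ε (below i k) j)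
      (fun k => δ i j (below i k)) (fun k => η i j (below i k))) * (1 + ε i j)
  else
    flSubDot (U i j) i.val
      (fun k => flChol U δ η ε (below i k) i) (fun k => flChol U δ η ε (below i k) j)
      (fun k => δ i j (below i k)) (fun k => η i j (below i k))
    / flChol U δ η ε i i * (1 + ε i j)
termination_by (i.val, j.val)
decreasing_by
  · exact Prod.Lex.left _ _ k.isLt
  · exact Prod.Lex.left _ _ k.isLt
  · exact Prod.Lex.left _ _ k.isLt
  · exact Prod.Lex.left _ _ k.isLt
  · exact Prod.Lex.right _ (Fin.lt_def.mp (lt_of_le_of_ne (not_lt.mp _h) _h'))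

/-- The computed radicand of the `j`-th diagonal entry in `flChol`. -/
noncomputable def flPivot {n : ℕ} (U : Matrix (Fin n) (Fin n) ℝ)
    (δ η : Fin n → Fin n → Fin n → ℝ) (ε : Fin n → Fin n → ℝ) (j : Fin n) : ℝ :=
  flSubDot (U j j) j.val
    (fun k => flChol U δ η ε (below j k) j) (fun k => flChol U δ η ε (below j k) j)
    (fun k => δ j j (below j k)) (fun k => η j j (below j k))

/-- Computed solution `q` of `qᵀ V = tᵀ` for an upper triangular `V`, by substitution:
`q j = (t j - ∑ k < j, q k * V k j) / V j j`, where `ε j` is the error of the division. -/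
noncomputable def flSolve {n : ℕ} (V : Matrix (Fin n) (Fin n) ℝ) (t : Fin n → ℝ)
    (δ η : Fin n → Fin n → ℝ) (ε : Fin n → ℝ) (j : Fin n) : ℝ :=
  flSubDot (t j) j.val
    (fun k => flSolve V t δ η ε (below j k)) (fun k => V (below j k) j)
    (fun k => δ j (below j k)) (fun k => η j (below j k))
  / V j j * (1 + ε j)
termination_by j.val
decreasing_by exact k.isLt

/-! ### CholeskyQR and CholeskyQR2 with rounding errors -/

/-- Labels of the elementary operations in one run of CholeskyQR on an `m × n` matrix. -/
inductive StepOp (m n : ℕ) : Type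
  /-- multiplications in the Gram matrix -/
  | gramMul (i j : Fin n) (k : Fin m)
  /-- additions in the Gram matrix -/
  | gramAdd (i j : Fin n) (k : Fin m)
  /-- multiplications in the Cholesky factorization -/
  | cholMul (i j k : Fin n)
  /-- subtractions in the Cholesky factorization -/
  | cholSub (i j k : Fin n)
  /-- divisions (`i < j`) and square roots (`i = j`) in the Cholesky factorization -/
  | cholFin (i j : Fin n)
  /-- multiplications in the triangular solve for row `i` -/
  | solveMul (i : Fin m) (j k : Fin n)
  /-- subtractions in the triangular solve for row `i` -/
  | solveSub (i : Fin m) (j k : Fin n)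
  /-- divisions in the triangular solve for row `i` -/
  | solveDiv (i : Fin m) (j : Fin n)

/-- Labels of the elementary operations in CholeskyQR2: those of the two runs of CholeskyQR, and
those of the final product of the two triangular factors. Some labels belong to no operation; their
errors are not used. -/
inductive Op (m n : ℕ) : Type
  | first (o : StepOp m n)
  | second (o : StepOp m n)
  | prodMul (i j k : Fin n)
  | prodAdd (i j k : Fin n)

section Step

variable {m n : ℕ} (A : Matrix (Fin m) (Fin n) ℝ) (e : StepOp m n → ℝ)

/-- Computed Gram matrix `U = fl(Aᵀ A)`. -/
noncomputable def stepU : Matrix (Fin n) (Fin n) ℝ :=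
  flMul A.transpose A (fun i j k => e (.gramMul i j k)) (fun i j k => e (.gramAdd i j k))

/-- Computed Cholesky factor `V` of `U`. -/
noncomputable def stepV : Matrix (Fin n) (Fin n) ℝ :=
  Matrix.of (flChol (stepU A e) (fun i j k => e (.cholMul i j k)) (fun i j k => e (.cholSub i j k))
    (fun i j => e (.cholFin i j)))

/-- The Cholesky factorization runs to completion: all computed radicands are positive. -/
def StepCompletes : Prop :=
  ∀ j, 0 < flPivot (stepU A e) (fun i j k => e (.cholMul i j k)) (fun i j k => e (.cholSub i j k))
    (fun i j => e (.cholFin i j)) j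

/-- Computed orthogonal factor `Q = fl(A V⁻¹)`, one triangular solve for each row. -/
noncomputable def stepQ : Matrix (Fin m) (Fin n) ℝ :=
  Matrix.of fun i => flSolve (stepV A e) (A i) (fun j k => e (.solveMul i j k))
    (fun j k => e (.solveSub i j k)) (fun j => e (.solveDiv i j))

end Step

section Algorithm

variable {m n : ℕ} (T : Matrix (Fin m) (Fin n) ℝ) (e : Op m n → ℝ)

/-- `V` of `[Q, V] = CholeskyQR(T)`. -/
noncomputable def outV : Matrix (Fin n) (Fin n) ℝ := stepV T (fun o => e (.first o))

/-- `Q` of `[Q, V] = CholeskyQR(T)`. -/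
noncomputable def outQ : Matrix (Fin m) (Fin n) ℝ := stepQ T (fun o => e (.first o))

/-- `V₁` of `[Q₁, V₁] = CholeskyQR(Q)`. -/
noncomputable def outV1 : Matrix (Fin n) (Fin n) ℝ := stepV (outQ T e) (fun o => e (.second o))

/-- `Q₁` of `[Q₁, V₁] = CholeskyQR(Q)`. -/
noncomputable def outQ1 : Matrix (Fin m) (Fin n) ℝ := stepQ (outQ T e) (fun o => e (.second o))

/-- `V₂ = fl(V₁ V)`. -/
noncomputable def outV2 : Matrix (Fin n) (Fin n) ℝ :=
  flMul (outV1 T e) (outV T e) (fun i j k => e (.prodMul i j k)) (fun i j k => e (.prodAdd i j k))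

/-- The first CholeskyQR runs to completion. -/
def FirstCompletes : Prop := StepCompletes T (fun o => e (.first o))

/-- The second CholeskyQR runs to completion. -/
def SecondCompletes : Prop := StepCompletes (outQ T e) (fun o => e (.second o))

end Algorithm

end CholQR

/-!
CholeskyQR2 in floating-point arithmetic satisfies its error bounds because of three facts.

*Accumulated rounding errors.* Every computed quantity is an exact expression in which each term
carries a product of factors `1 + δ`. Such a product is within `exp (± b)`, where `b` is the modulus
of the sum of the errors `δ` plus a term of second order (`near_prod_one_add`). If the sums of the
errors of consecutive additions are of size `λ √k u`, then the Gram matrix, the Cholesky factor and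
the triangular solves have backward errors that are relative, entrywise, and of size `λ √m u`,
`λ √(n + 1) u` and `λ √n u` (`ErrorsBounded.isPerturbedCholesky`,
`ErrorsBounded.isPerturbedSolve`).

*Perturbation theory.* Let `‖A x‖ ≥ σ ‖x‖`, and let the errors of the Gram matrix and of the
factorization be small compared with `σ² / ‖A‖_g²`. Then no pivot can vanish: the first one that
does would give a kernel vector of the computed factor on which `A` is nonetheless bounded below
(`IsPerturbedCholesky.diag_pos`). Hence the quadratic forms of `V` and `A` agree up to three percent,
and the computed quotient `Q` is nearly orthogonal, with singular values in `[0.98, 1.02]`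
(`IsPerturbedSolve.vnorm_mulVec_bounds`). The second run therefore starts from a matrix with condition
number close to `1` and with `‖Q‖_g / ‖Q‖₂` close to `1`, which gives the orthogonality bound
(`SmallRoundoff.frobNorm_orth_le`). The residual is the sum of the errors of the two solves and of
the product of the triangular factors (`frobNorm_residual_le`).

*Probability.* By Hoeffding's inequality a given sum of errors exceeds its bound with probability at
most `1 - P(λ)` (`measureReal_lt_abs_sum_le`). The union bound is applied only within each of five
groups of errors; the groups are disjoint, so that the events are independent and the probabilities
multiply (`measureReal_biInter_eq_prod`). The sums for the Gram matrix and for the triangular solves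
of a run together number at most `m n²`, since only the upper triangle of the Gram matrix is read.
-/

namespace CholQR

/-! ### Accumulated rounding factors -/

/-- `F` lies between `exp (-b)` and `exp b`. Accumulated rounding factors are measured on this
multiplicative scale, since it is symmetric under inversion. -/
def Near (b F : ℝ) : Prop := Real.exp (-b) ≤ F ∧ F ≤ Real.exp b

theorem Near.pos {b F : ℝ} (h : Near b F) : 0 < F := (Real.exp_pos _).trans_le h.1

theorem Near.mono {b b' F : ℝ} (h : Near b F) (hb : b ≤ b') : Near b' F :=
  ⟨(Real.exp_le_exp.2 (by linarith)).trans h.1, h.2.trans (Real.exp_le_exp.2 hb)⟩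

theorem Near.mul {b b' F F' : ℝ} (h : Near b F) (h' : Near b' F') : Near (b + b') (F * F') := by
  refine ⟨?_, ?_⟩
  · rw [neg_add, Real.exp_add]
    exact mul_le_mul h.1 h'.1 (Real.exp_pos _).le h.pos.le
  · rw [Real.exp_add]
    exact mul_le_mul h.2 h'.2 h'.pos.le (Real.exp_pos _).le

theorem Near.inv {b F : ℝ} (h : Near b F) : Near b F⁻¹ := by
  refine ⟨?_, ?_⟩
  · rw [Real.exp_neg]
    exact inv_anti₀ h.pos h.2
  · rw [show Real.exp b = (Real.exp (-b))⁻¹ by rw [Real.exp_neg, inv_inv]]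
    exact inv_anti₀ (Real.exp_pos _) h.1

theorem Near.abs_sub_one_le {b F : ℝ} (h : Near b F) : |F - 1| ≤ Real.exp b - 1 := by
  have h2 : 2 ≤ Real.exp b + Real.exp (-b) := by
    have := Real.add_one_le_exp b
    have := Real.add_one_le_exp (-b)
    linarith
  rw [abs_le]
  constructor <;> linarith [h.1, h.2]

theorem exp_sub_two_mul_sq_le {x : ℝ} (hx : |x| ≤ 1 / 2) : Real.exp (x - 2 * x ^ 2) ≤ 1 + x := by
  have h1 := (abs_le.1 hx).1
  have hpos : 0 < 1 + x := by linarith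
  rw [← Real.le_log_iff_exp_le hpos]
  refine le_trans ?_ (Real.one_sub_inv_le_log_of_pos hpos)
  rw [← sub_nonneg]
  have : 1 - (1 + x)⁻¹ - (x - 2 * x ^ 2) = x ^ 2 * (1 + 2 * x) / (1 + x) := by
    field_simp
    ring
  rw [this]
  exact div_nonneg (mul_nonneg (sq_nonneg _) (by linarith)) hpos.le

/-- The sum of the errors governs the product of the rounding factors up to second order. -/
theorem near_prod_one_add {ι : Type*} (S : Finset ι) (η : ι → ℝ) {u B L : ℝ} (hu : u ≤ 1 / 2)
    (hη : ∀ i, |η i| ≤ u) (hB : |∑ i ∈ S, η i| ≤ B) (hL : S.card ≤ L) :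
    Near (B + 2 * L * u ^ 2) (∏ i ∈ S, (1 + η i)) := by
  have hpos : ∀ i, 0 ≤ 1 + η i := fun i => by linarith [(abs_le.1 (hη i)).1]
  constructor
  · calc Real.exp (-(B + 2 * L * u ^ 2)) ≤ Real.exp (∑ i ∈ S, (η i - 2 * η i ^ 2)) := by
          rw [Real.exp_le_exp, Finset.sum_sub_distrib]
          have h1 := (abs_le.1 hB).1
          have h2 : ∑ i ∈ S, 2 * η i ^ 2 ≤ S.card * (2 * u ^ 2) := by
            rw [← nsmul_eq_mul]
            refine Finset.sum_le_card_nsmul _ _ _ fun i _ => ?_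
            have := sq_le_sq' (abs_le.1 (hη i)).1 (abs_le.1 (hη i)).2
            linarith
          have h3 : (S.card : ℝ) * (2 * u ^ 2) ≤ L * (2 * u ^ 2) :=
            mul_le_mul_of_nonneg_right hL (by positivity)
          linarith
      _ = ∏ i ∈ S, Real.exp (η i - 2 * η i ^ 2) := Real.exp_sum _ _
      _ ≤ ∏ i ∈ S, (1 + η i) := Finset.prod_le_prod (fun _ _ => (Real.exp_pos _).le)
          fun i _ => exp_sub_two_mul_sq_le ((hη i).trans hu)
  · calc ∏ i ∈ S, (1 + η i) ≤ ∏ i ∈ S, Real.exp (η i) :=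
          Finset.prod_le_prod (fun i _ => hpos i) fun i _ => by
            linarith [Real.add_one_le_exp (η i)]
      _ = Real.exp (∑ i ∈ S, η i) := (Real.exp_sum _ _).symm
      _ ≤ Real.exp (B + 2 * L * u ^ 2) := by
          rw [Real.exp_le_exp]
          have : 0 ≤ L * u ^ 2 := mul_nonneg ((Nat.cast_nonneg _).trans hL) (sq_nonneg u)
          linarith [(abs_le.1 hB).2]

theorem near_one_add {u x : ℝ} (hu : u ≤ 1 / 2) (hx : |x| ≤ u) :
    Near (u + 2 * u ^ 2) (1 + x) := by
  simpa using near_prod_one_add (L := 1) {()} (fun _ => x) hu (fun _ => hx) (by simpa) (by simp)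

/-! ### Backward error of the rounded kernels -/

theorem flDot_succ_eq (k : ℕ) (x y δ η : Fin (k + 1) → ℝ) :
    flDot (k + 1) x y δ η = ∑ i, x i * y i *
      ((1 + δ i) * ∏ l with i ≤ l ∧ 0 < l.val, (1 + η l)) := by
  induction k with
  | zero => simp [flDot]
  | succ k ih =>
    rw [flDot, ih, Fin.sum_univ_castSucc (n := k + 1), add_mul, Finset.sum_mul]
    congr 1
    · refine Finset.sum_congr rfl fun i _ => ?_
      rw [mul_assoc, mul_assoc (1 + δ _)]
      congr 2
      simp only [Finset.prod_filter]
      rw [Fin.prod_univ_castSucc (n := k + 1)]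
      simp [Fin.le_last]
    · rw [mul_assoc]
      congr 2
      rw [Finset.prod_eq_single (Fin.last (k + 1))]
      · simp +contextual [Fin.last_le_iff]
      · simp

/-- A rounded inner product is an exact one with perturbed products. The bound `B` is on the sums
of the errors of the additions that a product goes through. -/
theorem exists_flDot_eq {k : ℕ} (x y δ η : Fin k → ℝ) {u B : ℝ} (hu : u ≤ 1 / 2)
    (hδ : ∀ i, |δ i| ≤ u) (hη : ∀ i, |η i| ≤ u)
    (hB : ∀ r : Fin k, |∑ l with r ≤ l ∧ 0 < l.val, η l| ≤ B) :
    ∃ w : Fin k → ℝ, (∀ i, Near (B + u + 2 * (k + 1) * u ^ 2) (w i)) ∧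
      flDot k x y δ η = ∑ i, x i * y i * w i := by
  cases k with
  | zero => exact ⟨fun _ => 1, fun i => i.elim0, by simp [flDot]⟩
  | succ k =>
    refine ⟨_, fun i => ?_, flDot_succ_eq k x y δ η⟩
    refine ((near_one_add hu (hδ i)).mul
      (near_prod_one_add (L := (k + 1 : ℕ)) _ η hu hη (hB i) ?_)).mono (by push_cast; linarith)
    exact_mod_cast (Finset.card_le_univ _).trans (by simp)

theorem abs_sum_mul_sub_le {ι : Type*} (S : Finset ι) (x y w : ι → ℝ) {b : ℝ}
    (hw : ∀ i ∈ S, Near b (w i)) :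
    |∑ i ∈ S, x i * y i * w i - ∑ i ∈ S, x i * y i|
      ≤ (Real.exp b - 1) * ∑ i ∈ S, |x i| * |y i| := by
  rw [← Finset.sum_sub_distrib, Finset.mul_sum]
  refine (Finset.abs_sum_le_sum_abs _ _).trans (Finset.sum_le_sum fun i hi => ?_)
  rw [show x i * y i * w i - x i * y i = (x i * y i) * (w i - 1) by ring, abs_mul, abs_mul,
    mul_comm]
  exact mul_le_mul_of_nonneg_right (hw i hi).abs_sub_one_le (by positivity)

theorem flSubDot_eq (c : ℝ) (k : ℕ) (x y δ η : Fin k → ℝ) (hη : ∀ i, 1 + η i ≠ 0) :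
    c = flSubDot c k x y δ η * (∏ l, (1 + η l))⁻¹ +
      ∑ i, x i * y i * ((1 + δ i) * (∏ l with l.val < i.val, (1 + η l))⁻¹) := by
  induction k with
  | zero => simp [flSubDot]
  | succ k ih =>
    conv_lhs => rw [ih (fun i => x i.castSucc) (fun i => y i.castSucc)
          (fun i => δ i.castSucc) (fun i => η i.castSucc) (fun i => hη _)]
    rw [flSubDot, Fin.sum_univ_castSucc, Fin.prod_univ_castSucc]
    have h1 : ∀ i : Fin k, (∏ l : Fin (k + 1) with l.val < i.castSucc.val, (1 + η l))
        = ∏ l : Fin k with l.val < i.val, (1 + η l.castSucc) := by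
      intro i
      simp only [Finset.prod_filter]
      rw [Fin.prod_univ_castSucc]
      simp [not_lt.2 i.isLt.le]
    have h2 : (∏ l : Fin (k + 1) with l.val < (Fin.last k).val, (1 + η l))
        = ∏ l : Fin k, (1 + η l.castSucc) := by
      simp only [Finset.prod_filter]
      rw [Fin.prod_univ_castSucc]
      simp
    simp only [h1, h2]
    have h3 : (∏ l : Fin k, (1 + η l.castSucc)) ≠ 0 := Finset.prod_ne_zero_iff.2 fun i _ => hη _
    have h4 := hη (Fin.last k)
    field_simp
    ring

/-- The input `c` of a rounded `c - ∑ x k * y k` is recovered from the output up to perturbed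
factors. The bound `B` is on the sums of the errors of the first subtractions. -/
theorem exists_flSubDot_eq (c : ℝ) {k : ℕ} (x y δ η : Fin k → ℝ) {u B : ℝ} (hu : u ≤ 1 / 2)
    (hδ : ∀ i, |δ i| ≤ u) (hη : ∀ i, |η i| ≤ u)
    (hB : ∀ r : ℕ, |∑ l : Fin k with l.val < r, η l| ≤ B) :
    ∃ (w₀ : ℝ) (w : Fin k → ℝ), Near (B + 2 * k * u ^ 2) w₀ ∧
      (∀ i, Near (B + u + 2 * (k + 1) * u ^ 2) (w i)) ∧
      c = flSubDot c k x y δ η * w₀ + ∑ i, x i * y i * w i := by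
  refine ⟨_, _, ?_, fun i => ?_, flSubDot_eq c k x y δ η fun i => ?_⟩
  · refine (near_prod_one_add _ η hu hη ?_ ?_).inv
    · simpa [Finset.filter_true_of_mem] using hB k
    · simp
  · refine ((near_one_add hu (hδ i)).mul
      (near_prod_one_add (L := k) _ η hu hη (hB i) ?_).inv).mono (by linarith)
    exact_mod_cast (Finset.card_le_univ _).trans (by simp)
  · linarith [(abs_le.1 (hη i)).1]

/-! ### Euclidean, Frobenius and spectral norms -/

/-- The Euclidean norm of a coordinate vector. -/
noncomputable def vnorm {n : ℕ} (x : Fin n → ℝ) : ℝ := ‖WithLp.toLp 2 x‖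

section Vectors

variable {n : ℕ} (x y : Fin n → ℝ)

theorem vnorm_nonneg : 0 ≤ vnorm x := norm_nonneg _

theorem vnorm_sq : vnorm x ^ 2 = ∑ i, x i ^ 2 := by
  simp [vnorm, EuclideanSpace.norm_sq_eq]

theorem vnorm_eq_sqrt : vnorm x = √(∑ i, x i ^ 2) := by
  rw [← vnorm_sq, Real.sqrt_sq (vnorm_nonneg x)]

theorem vnorm_add_le : vnorm (x + y) ≤ vnorm x + vnorm y := norm_add_le _ _

theorem vnorm_neg : vnorm (-x) = vnorm x := by simp [vnorm_eq_sqrt]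

theorem vnorm_abs : vnorm (fun i => |x i|) = vnorm x := by simp [vnorm_eq_sqrt]

theorem vnorm_eq_zero : vnorm x = 0 ↔ x = 0 := by
  simp [vnorm]

theorem sum_mul_le_vnorm_mul : ∑ i, x i * y i ≤ vnorm x * vnorm y := by
  rw [vnorm_eq_sqrt, vnorm_eq_sqrt]
  exact Real.sum_mul_le_sqrt_mul_sqrt _ _ _

theorem sum_abs_mul_le_vnorm_mul : ∑ i, |x i| * |y i| ≤ vnorm x * vnorm y := by
  simpa only [vnorm_abs] using sum_mul_le_vnorm_mul (fun i => |x i|) (fun i => |y i|)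

theorem sq_sum_abs_le : (∑ i, |x i|) ^ 2 ≤ n * vnorm x ^ 2 := by
  have := sq_sum_le_card_mul_sum_sq (s := Finset.univ) (f := fun i => |x i|)
  simpa [vnorm_sq] using this

theorem vnorm_single (k : Fin n) : vnorm (Pi.single k 1) = 1 := by
  have : vnorm (Pi.single k (1 : ℝ)) ^ 2 = 1 := by
    rw [vnorm_sq, Finset.sum_eq_single k] <;> simp +contextual
  nlinarith [vnorm_nonneg (Pi.single k (1 : ℝ))]

end Vectors

section Matrices

variable {l m n : ℕ}

/-- The Euclidean norm of the `j`-th column. -/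
noncomputable def colNorm (A : Matrix (Fin m) (Fin n) ℝ) (j : Fin n) : ℝ := vnorm fun i => A i j

theorem colNorm_nonneg (A : Matrix (Fin m) (Fin n) ℝ) (j : Fin n) : 0 ≤ colNorm A j :=
  vnorm_nonneg _

theorem colNorm_sq (A : Matrix (Fin m) (Fin n) ℝ) (j : Fin n) :
    colNorm A j ^ 2 = (A.transpose * A) j j := by
  rw [colNorm, vnorm_sq]
  simp [Matrix.mul_apply, sq]

theorem colNorm_eq_vnorm_mulVec (A : Matrix (Fin m) (Fin n) ℝ) (j : Fin n) :
    colNorm A j = vnorm (A.mulVec (Pi.single j 1)) := by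
  simp [colNorm, Matrix.col]; rfl

theorem colNorm_le_gNorm (A : Matrix (Fin m) (Fin n) ℝ) (j : Fin n) : colNorm A j ≤ gNorm A :=
  le_ciSup (f := fun j => colNorm A j) (Set.finite_range _).bddAbove j

theorem gNorm_nonneg (A : Matrix (Fin m) (Fin n) ℝ) : 0 ≤ gNorm A :=
  Real.iSup_nonneg fun _ => norm_nonneg _

theorem gNorm_le {A : Matrix (Fin m) (Fin n) ℝ} {c : ℝ} (hn : 0 < n) (h : ∀ j, colNorm A j ≤ c) :
    gNorm A ≤ c :=
  haveI : Nonempty (Fin n) := ⟨⟨0, hn⟩⟩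
  ciSup_le h

theorem specNorm_nonneg (A : Matrix (Fin m) (Fin n) ℝ) : 0 ≤ specNorm A := by
  let _ := Matrix.instL2OpNormedAddCommGroup (m := Fin m) (n := Fin n) (𝕜 := ℝ)
  exact norm_nonneg A

theorem vnorm_mulVec_le (A : Matrix (Fin m) (Fin n) ℝ) (x : Fin n → ℝ) :
    vnorm (A.mulVec x) ≤ specNorm A * vnorm x :=
  Matrix.l2_opNorm_mulVec A (WithLp.toLp 2 x)

theorem specNorm_le {A : Matrix (Fin m) (Fin n) ℝ} {c : ℝ} (hc : 0 ≤ c)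
    (h : ∀ x, vnorm (A.mulVec x) ≤ c * vnorm x) : specNorm A ≤ c := by
  unfold specNorm
  rw [Matrix.l2_opNorm_def]
  exact ContinuousLinearMap.opNorm_le_bound _ hc fun x => h x.ofLp

theorem specNorm_transpose (A : Matrix (Fin m) (Fin n) ℝ) :
    specNorm A.transpose = specNorm A := by
  rw [← Matrix.conjTranspose_eq_transpose_of_trivial]
  exact Matrix.l2_opNorm_conjTranspose A

theorem frobNorm_nonneg (A : Matrix (Fin m) (Fin n) ℝ) : 0 ≤ frobNorm A := by
  let _ := Matrix.frobeniusNormedAddCommGroup (m := Fin m) (n := Fin n) (α := ℝ)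
  exact norm_nonneg A

theorem frobNorm_sq (A : Matrix (Fin m) (Fin n) ℝ) : frobNorm A ^ 2 = ∑ i, ∑ j, A i j ^ 2 := by
  unfold frobNorm
  rw [Matrix.frobenius_norm_def, ← Real.sqrt_eq_rpow, Real.sq_sqrt (by positivity)]
  simp

theorem frobNorm_sq_eq_sum_colNorm (A : Matrix (Fin m) (Fin n) ℝ) :
    frobNorm A ^ 2 = ∑ j, colNorm A j ^ 2 := by
  rw [frobNorm_sq, Finset.sum_comm]
  simp [colNorm, vnorm_sq]

theorem frobNorm_add_le (A B : Matrix (Fin m) (Fin n) ℝ) :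
    frobNorm (A + B) ≤ frobNorm A + frobNorm B := by
  let _ := Matrix.frobeniusNormedAddCommGroup (m := Fin m) (n := Fin n) (α := ℝ)
  exact norm_add_le A B

theorem frobNorm_sub_le (A B : Matrix (Fin m) (Fin n) ℝ) :
    frobNorm (A - B) ≤ frobNorm A + frobNorm B := by
  let _ := Matrix.frobeniusNormedAddCommGroup (m := Fin m) (n := Fin n) (α := ℝ)
  exact norm_sub_le A B

theorem frobNorm_transpose (A : Matrix (Fin m) (Fin n) ℝ) :
    frobNorm A.transpose = frobNorm A := Matrix.frobenius_norm_transpose A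

theorem frobNorm_mul_le (A : Matrix (Fin l) (Fin m) ℝ) (B : Matrix (Fin m) (Fin n) ℝ) :
    frobNorm (A * B) ≤ frobNorm A * frobNorm B := Matrix.frobenius_norm_mul A B

/-- Entrywise domination carries over to the Frobenius norm. -/
theorem frobNorm_le_of_abs_le {A B : Matrix (Fin m) (Fin n) ℝ} {c : ℝ} (hc : 0 ≤ c)
    (h : ∀ i j, |A i j| ≤ c * B i j) : frobNorm A ≤ c * frobNorm B := by
  refine abs_le_of_sq_le_sq' ?_ (mul_nonneg hc (frobNorm_nonneg B)) |>.2
  rw [mul_pow, frobNorm_sq, frobNorm_sq, Finset.mul_sum]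
  refine Finset.sum_le_sum fun i _ => ?_
  rw [Finset.mul_sum]
  refine Finset.sum_le_sum fun j _ => ?_
  rw [← mul_pow, ← sq_abs]
  exact pow_le_pow_left₀ (abs_nonneg _) (h i j) 2

theorem frobNorm_abs (A : Matrix (Fin m) (Fin n) ℝ) :
    frobNorm (Matrix.of fun i j => |A i j|) = frobNorm A := by
  have : frobNorm (Matrix.of fun i j => |A i j|) ^ 2 = frobNorm A ^ 2 := by
    simp [frobNorm_sq]
  exact (pow_left_inj₀ (frobNorm_nonneg _) (frobNorm_nonneg _) two_ne_zero).1 this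

/-- A componentwise error bound `c |A| |B|` in terms of Frobenius norms. -/
theorem frobNorm_le_of_abs_le_sum {E : Matrix (Fin l) (Fin n) ℝ} {A : Matrix (Fin l) (Fin m) ℝ}
    {B : Matrix (Fin m) (Fin n) ℝ} {c : ℝ} (hc : 0 ≤ c)
    (h : ∀ i j, |E i j| ≤ c * ∑ k, |A i k| * |B k j|) :
    frobNorm E ≤ c * (frobNorm A * frobNorm B) := by
  refine (frobNorm_le_of_abs_le
    (B := (Matrix.of fun i j => |A i j|) * (Matrix.of fun i j => |B i j|)) hc ?_).trans ?_
  · simpa [Matrix.mul_apply] using h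
  · refine mul_le_mul_of_nonneg_left ?_ hc
    simpa only [frobNorm_abs] using
      frobNorm_mul_le (Matrix.of fun i j => |A i j|) (Matrix.of fun i j => |B i j|)

theorem colNorm_mul (A : Matrix (Fin l) (Fin m) ℝ) (B : Matrix (Fin m) (Fin n) ℝ) (j : Fin n) :
    colNorm (A * B) j = vnorm (A.mulVec fun k => B k j) := rfl

theorem frobNorm_mul_le_specNorm_mul (A : Matrix (Fin l) (Fin m) ℝ)
    (B : Matrix (Fin m) (Fin n) ℝ) : frobNorm (A * B) ≤ specNorm A * frobNorm B := by
  refine abs_le_of_sq_le_sq' ?_ (mul_nonneg (specNorm_nonneg A) (frobNorm_nonneg B)) |>.2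
  rw [mul_pow, frobNorm_sq_eq_sum_colNorm, frobNorm_sq_eq_sum_colNorm, Finset.mul_sum]
  refine Finset.sum_le_sum fun j _ => ?_
  rw [← mul_pow, colNorm_mul]
  exact pow_le_pow_left₀ (vnorm_nonneg _) (vnorm_mulVec_le _ _) 2

theorem frobNorm_mul_le_mul_specNorm (A : Matrix (Fin l) (Fin m) ℝ)
    (B : Matrix (Fin m) (Fin n) ℝ) : frobNorm (A * B) ≤ frobNorm A * specNorm B := by
  rw [← frobNorm_transpose, Matrix.transpose_mul, mul_comm, ← frobNorm_transpose A,
    ← specNorm_transpose B]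
  exact frobNorm_mul_le_specNorm_mul _ _

theorem vnorm_mulVec_le_frobNorm_mul (A : Matrix (Fin m) (Fin n) ℝ) (x : Fin n → ℝ) :
    vnorm (A.mulVec x) ≤ frobNorm A * vnorm x := by
  refine abs_le_of_sq_le_sq' ?_ (mul_nonneg (frobNorm_nonneg A) (vnorm_nonneg x)) |>.2
  rw [mul_pow, vnorm_sq, frobNorm_sq, vnorm_sq, Finset.sum_mul]
  exact Finset.sum_le_sum fun i _ => by
    simpa [Matrix.mulVec, dotProduct] using Finset.sum_mul_sq_le_sq_mul_sq Finset.univ (A i) x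

theorem frobNorm_sq_le {A : Matrix (Fin m) (Fin n) ℝ} {c : ℝ} (h : ∀ j, colNorm A j ≤ c) :
    frobNorm A ^ 2 ≤ n * c ^ 2 := by
  rw [frobNorm_sq_eq_sum_colNorm]
  refine (Finset.sum_le_card_nsmul _ _ (c ^ 2) fun j _ =>
    pow_le_pow_left₀ (colNorm_nonneg A j) (h j) 2).trans ?_
  simp

theorem frobNorm_le_sqrt_mul {A : Matrix (Fin m) (Fin n) ℝ} {c : ℝ} (hc : 0 ≤ c)
    (h : ∀ j, colNorm A j ≤ c) : frobNorm A ≤ √n * c := by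
  refine abs_le_of_sq_le_sq' ?_ (by positivity) |>.2
  rw [mul_pow, Real.sq_sqrt (Nat.cast_nonneg n)]
  exact frobNorm_sq_le h

theorem frobNorm_le_of_abs_le_const {A : Matrix (Fin n) (Fin n) ℝ} {c : ℝ} (hc : 0 ≤ c)
    (h : ∀ i j, |A i j| ≤ c) : frobNorm A ≤ n * c := by
  refine abs_le_of_sq_le_sq' ?_ (by positivity) |>.2
  rw [frobNorm_sq]
  calc ∑ i, ∑ j, A i j ^ 2 ≤ ∑ _i : Fin n, ∑ _j : Fin n, c ^ 2 :=
        Finset.sum_le_sum fun i _ => Finset.sum_le_sum fun j _ => by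
          rw [← sq_abs]; exact pow_le_pow_left₀ (abs_nonneg _) (h i j) 2
    _ = (n * c) ^ 2 := by simp; ring

theorem gNorm_le_specNorm (hn : 0 < n) (A : Matrix (Fin m) (Fin n) ℝ) : gNorm A ≤ specNorm A :=
  gNorm_le hn fun j => by
    rw [colNorm_eq_vnorm_mulVec]
    simpa [vnorm_single] using vnorm_mulVec_le A (Pi.single j 1)

theorem specNorm_le_sqrt_mul_gNorm (A : Matrix (Fin m) (Fin n) ℝ) :
    specNorm A ≤ √n * gNorm A :=
  specNorm_le (mul_nonneg (Real.sqrt_nonneg _) (gNorm_nonneg A)) fun x =>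
    (vnorm_mulVec_le_frobNorm_mul A x).trans <| mul_le_mul_of_nonneg_right
      (frobNorm_le_sqrt_mul (gNorm_nonneg A) (colNorm_le_gNorm A)) (vnorm_nonneg x)

theorem gRatio_mem_Icc (hn : 0 < n) {A : Matrix (Fin m) (Fin n) ℝ} (hA : 0 < specNorm A) :
    1 / √n ≤ gRatio A ∧ gRatio A ≤ 1 := by
  have hs : 0 < √(n : ℝ) := Real.sqrt_pos.2 (by exact_mod_cast hn)
  constructor
  · rw [gRatio, div_le_div_iff₀ hs hA, one_mul, mul_comm]
    exact specNorm_le_sqrt_mul_gNorm A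
  · rw [gRatio, div_le_one hA]
    exact gNorm_le_specNorm hn A

theorem vnorm_mulVec_sq (A : Matrix (Fin m) (Fin n) ℝ) (x : Fin n → ℝ) :
    vnorm (A.mulVec x) ^ 2 = ∑ i, ∑ j, x i * x j * (A.transpose * A) i j := by
  have h1 : vnorm (A.mulVec x) ^ 2 = A.mulVec x ⬝ᵥ A.mulVec x := by
    rw [vnorm_sq]
    simp [dotProduct, sq]
  rw [h1, Matrix.dotProduct_mulVec, ← Matrix.mulVec_transpose, Matrix.mulVec_mulVec,
    dotProduct, Finset.sum_comm]
  simp only [Matrix.mulVec, dotProduct, Finset.sum_mul]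
  rw [Finset.sum_comm]
  refine Finset.sum_congr rfl fun i _ => Finset.sum_congr rfl fun j _ => ?_
  rw [← Matrix.transpose_apply (A.transpose * A), Matrix.transpose_mul, Matrix.transpose_transpose]
  ring

theorem sigmaMin_pos (hn : 0 < n) {A : Matrix (Fin m) (Fin n) ℝ} (hA : A.rank = n) :
    0 < sigmaMin A := by
  rw [sigmaMin, LinearMap.singularValues_pos_iff_lt_finrank_range,
    Matrix.toEuclideanLin_eq_toLin_orthonormal, ← Matrix.rank_eq_finrank_range_toLin A (EuclideanSpace.basisFun _ _).toBasis
      (EuclideanSpace.basisFun _ _).toBasis, hA]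
  omega

theorem sigmaMin_mul_vnorm_le (hn : 0 < n) (A : Matrix (Fin m) (Fin n) ℝ) (x : Fin n → ℝ) :
    sigmaMin A * vnorm x ≤ vnorm (A.mulVec x) := by
  set L := Matrix.toEuclideanLin A
  have hS := L.isSymmetric_adjoint_comp_self
  have hfin : Module.finrank ℝ (EuclideanSpace ℝ (Fin n)) = n := finrank_euclideanSpace_fin
  set b := hS.eigenvectorBasis hfin
  set z : EuclideanSpace ℝ (Fin n) := WithLp.toLp 2 x
  have hσ : ∀ i, sigmaMin A ^ 2 ≤ hS.eigenvalues hfin i := by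
    intro i
    rw [← L.sq_singularValues_fin hfin i]
    exact pow_le_pow_left₀ (L.singularValues_nonneg _) (L.singularValues_antitone (by omega)) 2
  have h1 : ‖L z‖ ^ 2 = ∑ i, hS.eigenvalues hfin i * inner ℝ (b i) z ^ 2 := by
    rw [← real_inner_self_eq_norm_sq, ← LinearMap.adjoint_inner_right, ← b.sum_inner_mul_inner]
    refine Finset.sum_congr rfl fun i _ => ?_
    have h2 := hS (b i) z
    rw [hS.apply_eigenvectorBasis, real_inner_smul_left] at h2
    simp only [LinearMap.comp_apply] at h2
    rw [← h2, real_inner_comm]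
    simp only [RCLike.ofReal_real_eq_id, id]
    ring
  have h3 : ‖z‖ ^ 2 = ∑ i, inner ℝ (b i) z ^ 2 := by
    rw [← b.sum_sq_norm_inner_right z]
    simp
  have h4 : (sigmaMin A * vnorm x) ^ 2 ≤ vnorm (A.mulVec x) ^ 2 := by
    change (sigmaMin A * ‖z‖) ^ 2 ≤ ‖L z‖ ^ 2
    rw [mul_pow, h1, h3, Finset.mul_sum]
    exact Finset.sum_le_sum fun i _ => mul_le_mul_of_nonneg_right (hσ i) (sq_nonneg _)
  exact abs_le_of_sq_le_sq' h4 (vnorm_nonneg _) |>.2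

end Matrices

/-! ### Perturbed Cholesky factorizations -/

section Cholesky

variable {m n : ℕ}

theorem sum_abs_le_mul_vnorm (z : Fin n → ℝ) : ∑ i, |z i| ≤ n * vnorm z := by
  rcases Nat.eq_zero_or_pos n with rfl | hn
  · simp
  have h1 : (1 : ℝ) ≤ n := by exact_mod_cast hn
  have hv := vnorm_nonneg z
  refine abs_le_of_sq_le_sq' ((sq_sum_abs_le z).trans ?_) (by positivity) |>.2
  rw [mul_pow]
  nlinarith [mul_nonneg (sub_nonneg.2 h1) (sq_nonneg (vnorm z))]

theorem sum_sum_mul_le {z : Fin n → ℝ} {E : Fin n → Fin n → ℝ} {ε : ℝ} (hε : 0 ≤ ε)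
    (h : ∀ i k, z i ≠ 0 → z k ≠ 0 → z i * z k * E i k ≤ |z i| * |z k| * ε) :
    ∑ i, ∑ k, z i * z k * E i k ≤ n * ε * vnorm z ^ 2 := by
  calc ∑ i, ∑ k, z i * z k * E i k ≤ ∑ i, ∑ k, |z i| * |z k| * ε := by
        refine Finset.sum_le_sum fun i _ => Finset.sum_le_sum fun k _ => ?_
        by_cases hi : z i = 0
        · simp [hi]
        by_cases hk : z k = 0
        · simp [hk]
        exact h i k hi hk
    _ = (∑ i, |z i|) ^ 2 * ε := by
        rw [sq, Finset.sum_mul_sum, Finset.sum_mul]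
        exact Finset.sum_congr rfl fun i _ => by rw [Finset.sum_mul]
    _ ≤ n * ε * vnorm z ^ 2 := by
        nlinarith [mul_le_mul_of_nonneg_right (sq_sum_abs_le z) hε]

theorem mul_mul_le_of_abs_le {a b e ε : ℝ} (h : |e| ≤ ε) : a * b * e ≤ |a| * |b| * ε := by
  rw [← abs_mul]
  exact (le_abs_self _).trans
    (by rw [abs_mul]; exact mul_le_mul_of_nonneg_left h (abs_nonneg _))

/-- `V` is a Cholesky factor of `Aᵀ A` up to rounding errors: `gA` and `gB` are the relative errors
of the Gram matrix and of the factorization. An exact zero on the diagonal of `V` stands for a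
factorization that broke down there; then only one of the two bounds on the diagonal is known. -/
structure IsPerturbedCholesky (A : Matrix (Fin m) (Fin n) ℝ) (V : Matrix (Fin n) (Fin n) ℝ)
    (gA gB : ℝ) : Prop where
  upper : ∀ k j, j < k → V k j = 0
  nonneg : ∀ j, 0 ≤ V j j
  err : ∀ i j, i ≤ j → 0 < V i i → |(V.transpose * V) i j - (A.transpose * A) i j|
    ≤ gA * (colNorm A i * colNorm A j) + gB * (colNorm V i * colNorm V j)
  err_zero : ∀ j, V j j = 0 → (A.transpose * A) j j - (V.transpose * V) j j
    ≤ gA * (colNorm A j * colNorm A j) + gB * (colNorm V j * colNorm V j)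

/-- The matrix `A` is well conditioned in comparison with the errors `gA` and `gB`: its columns
have norm at most `G`, and `σ` is a lower bound for its singular values. -/
structure IsWellConditioned (A : Matrix (Fin m) (Fin n) ℝ) (G σ gA gB : ℝ) : Prop where
  G_nonneg : 0 ≤ G
  σ_pos : 0 < σ
  gA_nonneg : 0 ≤ gA
  gB_nonneg : 0 ≤ gB
  gA_le : gA ≤ 1 / 1000
  gB_le : gB ≤ 1 / 1000
  col_le : ∀ j, colNorm A j ≤ G
  le_mulVec : ∀ x, σ * vnorm x ≤ vnorm (A.mulVec x)
  sq_le : n * ((gA + 1.07 * gB) * G ^ 2) ≤ 0.03 * σ ^ 2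
  A_le : n * gA * G ≤ 0.005 * σ
  B_le : n * gB * G ≤ 0.005 * σ

variable {A : Matrix (Fin m) (Fin n) ℝ} {V : Matrix (Fin n) (Fin n) ℝ} {G σ gA gB : ℝ}

theorem IsPerturbedCholesky.colNorm_le (hV : IsPerturbedCholesky A V gA gB)
    (hA : IsWellConditioned A G σ gA gB) {j : Fin n} (hj : 0 < V j j) :
    colNorm V j ≤ 1.002 * G := by
  have h1 := (abs_le.1 (hV.err j j le_rfl hj)).2
  rw [← colNorm_sq, ← colNorm_sq] at h1
  have hG := hA.G_nonneg
  refine abs_le_of_sq_le_sq' ?_ (by positivity) |>.2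
  have h2 : colNorm A j ^ 2 ≤ G ^ 2 := pow_le_pow_left₀ (colNorm_nonneg A j) (hA.col_le j) 2
  have h3 : gA * colNorm A j ^ 2 ≤ 1 / 1000 * G ^ 2 :=
    mul_le_mul hA.gA_le h2 (sq_nonneg _) (by norm_num)
  have h4 : gB * colNorm V j ^ 2 ≤ 1 / 1000 * colNorm V j ^ 2 :=
    mul_le_mul_of_nonneg_right hA.gB_le (sq_nonneg _)
  nlinarith [sq_nonneg G]

theorem err_bound_le (hA : IsWellConditioned A G σ gA gB) {c d : ℝ} {i j k l : Fin n}
    (hc : colNorm V i ≤ c * G) (hd : colNorm V j ≤ d * G) (hc0 : 0 ≤ c) :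
    gA * (colNorm A k * colNorm A l) + gB * (colNorm V i * colNorm V j)
      ≤ (gA + c * d * gB) * G ^ 2 := by
  have hG := hA.G_nonneg
  have h1 : colNorm A k * colNorm A l ≤ G * G :=
    mul_le_mul (hA.col_le k) (hA.col_le l) (colNorm_nonneg A l) hG
  have h2 : colNorm V i * colNorm V j ≤ c * G * (d * G) :=
    mul_le_mul hc hd (colNorm_nonneg V j) (by positivity)
  have h3 := mul_le_mul_of_nonneg_left h1 hA.gA_nonneg
  have h4 := mul_le_mul_of_nonneg_left h2 hA.gB_nonneg
  linarith

theorem transpose_mul_self_comm (A : Matrix (Fin m) (Fin n) ℝ) (i j : Fin n) :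
    (A.transpose * A) i j = (A.transpose * A) j i := by
  rw [← Matrix.transpose_apply (A.transpose * A), Matrix.transpose_mul, Matrix.transpose_transpose]

theorem IsPerturbedCholesky.abs_err_le (hV : IsPerturbedCholesky A V gA gB)
    (hA : IsWellConditioned A G σ gA gB) {i j : Fin n} (hi : 0 < V i i) (hj : 0 < V j j) :
    |(V.transpose * V) i j - (A.transpose * A) i j| ≤ (gA + 1.005 * gB) * G ^ 2 := by
  have hb : (gA + 1.002 * 1.002 * gB) * G ^ 2 ≤ (gA + 1.005 * gB) * G ^ 2 :=
    mul_le_mul_of_nonneg_right (by linarith [hA.gB_nonneg]) (sq_nonneg G)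
  have hci := hV.colNorm_le hA hi
  have hcj := hV.colNorm_le hA hj
  rcases le_total i j with hij | hij
  · exact (hV.err i j hij hi).trans ((err_bound_le hA hci hcj (by norm_num)).trans hb)
  · rw [transpose_mul_self_comm V, transpose_mul_self_comm A]
    exact (hV.err j i hij hj).trans ((err_bound_le hA hcj hci (by norm_num)).trans hb)

theorem vnorm_sq_sub_vnorm_sq (V : Matrix (Fin n) (Fin n) ℝ) (A : Matrix (Fin m) (Fin n) ℝ)
    (z : Fin n → ℝ) : vnorm (V.mulVec z) ^ 2 - vnorm (A.mulVec z) ^ 2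
      = ∑ i, ∑ k, z i * z k * ((V.transpose * V) i k - (A.transpose * A) i k) := by
  simp only [vnorm_mulVec_sq, mul_sub, Finset.sum_sub_distrib]

theorem abs_vnorm_sq_sub_le {z : Fin n → ℝ} {ε : ℝ} (hε : 0 ≤ ε)
    (h : ∀ i k, z i ≠ 0 → z k ≠ 0 → |(V.transpose * V) i k - (A.transpose * A) i k| ≤ ε) :
    |vnorm (V.mulVec z) ^ 2 - vnorm (A.mulVec z) ^ 2| ≤ n * ε * vnorm z ^ 2 := by
  refine abs_le'.2 ⟨?_, ?_⟩
  · rw [vnorm_sq_sub_vnorm_sq]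
    exact sum_sum_mul_le hε fun i k hi hk => mul_mul_le_of_abs_le (h i k hi hk)
  · rw [vnorm_sq_sub_vnorm_sq]
    simp only [← Finset.sum_neg_distrib, ← mul_neg]
    exact sum_sum_mul_le hε fun i k hi hk => mul_mul_le_of_abs_le (by rw [abs_neg]; exact h i k hi hk)

/-- In an upper triangular matrix, a column that vanishes on and below the diagonal is a
combination of the columns before it, if these have nonzero diagonal entries. -/
theorem exists_mulVec_eq_col (hup : ∀ k j, j < k → V k j = 0) {j : Fin n}
    (hpos : ∀ i < j, 0 < V i i) (hj : V j j = 0) :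
    ∃ c : Fin n → ℝ, (∀ i, ¬ i < j → c i = 0) ∧ V.mulVec c = fun k => V k j := by
  -- The trailing columns are replaced by unit vectors, which makes the matrix invertible.
  set W : Matrix (Fin n) (Fin n) ℝ :=
    Matrix.of fun i k => if k < j then V i k else if i = k then 1 else 0 with hW
  have hdet : IsUnit W.det := by
    have htri : W.BlockTriangular id := by
      intro i k hik
      have hne : i ≠ k := (ne_of_lt hik).symm
      simp only [hW, Matrix.of_apply, hne, if_false]
      split_ifs
      · exact hup i k hik
      · rfl
    rw [Matrix.det_of_isUpperTriangular htri, isUnit_iff_ne_zero, Finset.prod_ne_zero_iff]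
    intro i _
    simp only [hW, Matrix.of_apply, if_true]
    split_ifs with h
    · exact (hpos i h).ne'
    · exact one_ne_zero
  set c := W⁻¹.mulVec fun k => V k j with hc
  have hWc : W.mulVec c = fun k => V k j := by
    rw [hc, Matrix.mulVec_mulVec, Matrix.mul_nonsing_inv _ hdet, Matrix.one_mulVec]
  have hc0 : ∀ i, ¬ i < j → c i = 0 := by
    intro i hi
    have h1 := congrFun hWc i
    have h2 : V i j = 0 := by
      rcases (not_lt.1 hi).eq_or_lt with h | h
      · rw [← h, hj]
      · exact hup i j h
    rw [h2] at h1
    simp only [Matrix.mulVec, dotProduct] at h1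
    rw [Finset.sum_eq_single i] at h1
    · simpa [hW, hi] using h1
    · intro k _ hk
      simp only [hW, Matrix.of_apply, hk.symm, if_false]
      split_ifs with h
      · rw [hup i k (h.trans_le (not_lt.1 hi)), zero_mul]
      · exact zero_mul _
    · simp
  refine ⟨c, hc0, ?_⟩
  rw [← hWc]
  ext i
  simp only [Matrix.mulVec, dotProduct]
  refine Finset.sum_congr rfl fun k _ => ?_
  by_cases hk : k < j
  · simp [hW, hk]
  · simp [hc0 k hk]

theorem vnorm_sq_eq_sum_mul (M : Matrix (Fin m) (Fin n) ℝ) (c : Fin n → ℝ) (j : Fin n) :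
    ∑ k, M.mulVec c k * M k j = ∑ i, c i * (M.transpose * M) i j := by
  simp only [Matrix.mulVec, dotProduct, Matrix.mul_apply, Matrix.transpose_apply, Finset.sum_mul,
    Finset.mul_sum]
  rw [Finset.sum_comm]
  exact Finset.sum_congr rfl fun _ _ => Finset.sum_congr rfl fun _ _ => by ring

/-- The factorization does not break down: at the first zero pivot, `V` would have a kernel vector
supported on the leading columns, on which `A` is bounded below. -/
theorem IsPerturbedCholesky.diag_pos (hV : IsPerturbedCholesky A V gA gB)
    (hA : IsWellConditioned A G σ gA gB) (j : Fin n) : 0 < V j j := by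
  induction j using WellFoundedLT.induction with
  | ind j ih =>
  refine (hV.nonneg j).lt_of_ne' fun hj0 => ?_
  have hG := hA.G_nonneg
  have hσ := hA.σ_pos
  have hgA := hA.gA_nonneg
  have hgB := hA.gB_nonneg
  obtain ⟨c, hc0, hVc⟩ := exists_mulVec_eq_col hV.upper ih hj0
  set ε := (gA + 1.07 * gB) * G ^ 2 with hεdef
  have hε : 0 ≤ ε := by positivity
  have hlt : ∀ i, c i ≠ 0 → i < j := fun i hi => by
    by_contra h
    exact hi (hc0 i h)
  have hε1 : (gA + 1.005 * gB) * G ^ 2 ≤ ε :=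
    mul_le_mul_of_nonneg_right (by linarith) (sq_nonneg G)
  -- `N` is the norm of the column at which the factorization breaks down.
  set N := colNorm V j with hN
  have hN0 : 0 ≤ N := colNorm_nonneg V j
  have hNc : vnorm (V.mulVec c) = N := by rw [hVc]; rfl
  set a := vnorm (A.mulVec c)
  have ha0 : 0 ≤ a := vnorm_nonneg _
  have hca : σ * vnorm c ≤ a := hA.le_mulVec c
  have hvc := vnorm_nonneg c
  have hNa : a ≤ 1.0155 * N := by
    have h1 := abs_vnorm_sq_sub_le (A := A) (V := V) (z := c) hε fun i k hi hk =>
      (hV.abs_err_le hA (ih i (hlt i hi)) (ih k (hlt k hk))).trans hε1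
    rw [hNc] at h1
    have h2 := (abs_le.1 h1).1
    have h3 : n * ε * vnorm c ^ 2 ≤ 0.03 * a ^ 2 := by
      calc n * ε * vnorm c ^ 2 ≤ 0.03 * σ ^ 2 * vnorm c ^ 2 :=
            mul_le_mul_of_nonneg_right hA.sq_le (sq_nonneg _)
        _ = 0.03 * (σ * vnorm c) ^ 2 := by ring
        _ ≤ 0.03 * a ^ 2 := by
            have := pow_le_pow_left₀ (by positivity) hca 2
            linarith
    refine abs_le_of_sq_le_sq' ?_ (by positivity) |>.2
    nlinarith
  have hNG : N ≤ 1.03 * G := by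
    have h1 : N ^ 2 = ∑ i, c i * (V.transpose * V) i j := by
      rw [← vnorm_sq_eq_sum_mul, hVc, hN, colNorm, vnorm_sq]
      exact Finset.sum_congr rfl fun _ _ => sq _
    have h2 : ∑ i, c i * (A.transpose * A) i j ≤ a * G := by
      rw [← vnorm_sq_eq_sum_mul]
      exact (sum_mul_le_vnorm_mul _ _).trans
        (mul_le_mul_of_nonneg_left (hA.col_le j) ha0)
    have h3 : ∑ i, c i * ((V.transpose * V) i j - (A.transpose * A) i j)
        ≤ (∑ i, |c i|) * ((gA * G + 1.002 * gB * N) * G) := by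
      rw [Finset.sum_mul]
      refine Finset.sum_le_sum fun i _ => ?_
      by_cases hi : c i = 0
      · simp [hi]
      refine (le_abs_self _).trans ?_
      rw [abs_mul]
      refine mul_le_mul_of_nonneg_left ?_ (abs_nonneg _)
      have hVi := ih i (hlt i hi)
      refine (hV.err i j (hlt i hi).le hVi).trans ?_
      have h4 : colNorm A i * colNorm A j ≤ G * G :=
        mul_le_mul (hA.col_le i) (hA.col_le j) (colNorm_nonneg A j) hG
      have h5 : colNorm V i * N ≤ 1.002 * G * N :=
        mul_le_mul_of_nonneg_right (hV.colNorm_le hA hVi) hN0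
      have h6 := mul_le_mul_of_nonneg_left h4 hgA
      have h7 := mul_le_mul_of_nonneg_left h5 hgB
      linarith
    have h4 : (∑ i, |c i|) * ((gA * G + 1.002 * gB * N) * G)
        ≤ vnorm c * (n * gA * G * G + n * gB * G * (1.002 * N)) := by
      have := mul_le_mul_of_nonneg_right (sum_abs_le_mul_vnorm c)
        (show 0 ≤ (gA * G + 1.002 * gB * N) * G by positivity)
      linarith
    have h5 : n * gA * G * G + n * gB * G * (1.002 * N)
        ≤ 0.005 * σ * G + 0.005 * σ * (1.002 * N) :=
      add_le_add (mul_le_mul_of_nonneg_right hA.A_le hG)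
        (mul_le_mul_of_nonneg_right hA.B_le (by positivity))
    have h6 := mul_le_mul_of_nonneg_left h5 hvc
    have h7 : σ * vnorm c * (0.005 * G + 0.00501 * N) ≤ a * (0.005 * G + 0.00501 * N) :=
      mul_le_mul_of_nonneg_right hca (by positivity)
    have h8 : N ^ 2 ≤ a * (1.005 * G + 0.00501 * N) := by
      have : ∑ i, c i * (V.transpose * V) i j = ∑ i, c i * (A.transpose * A) i j
          + ∑ i, c i * ((V.transpose * V) i j - (A.transpose * A) i j) := by
        rw [← Finset.sum_add_distrib]
        exact Finset.sum_congr rfl fun _ _ => by ring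
      linarith
    have h9 : N * N ≤ N * (1.0155 * (1.005 * G + 0.00501 * N)) := by
      have := mul_le_mul_of_nonneg_right hNa (show 0 ≤ 1.005 * G + 0.00501 * N by positivity)
      linarith
    rcases hN0.eq_or_lt with h | h
    · rw [← h]; positivity
    · have := le_of_mul_le_mul_left h9 h
      linarith
  -- The kernel vector `z` of `V`.
  set z : Fin n → ℝ := Pi.single j 1 - c with hz
  have hzj : z j = 1 := by simp [hz, hc0 j (lt_irrefl j)]
  have hVz : V.mulVec z = 0 := by
    rw [hz, Matrix.mulVec_sub, hVc]
    ext k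
    simp
  have hzle : ∀ i, z i ≠ 0 → i ≠ j → i < j := fun i hi hij => hlt i fun h => hi (by simp [hz, h, hij])
  have hmix : ∀ i < j, |(V.transpose * V) i j - (A.transpose * A) i j| ≤ ε := fun i hi =>
    (hV.err i j hi.le (ih i hi)).trans <|
      (err_bound_le (c := 1.002) (d := 1.03) hA (hV.colNorm_le hA (ih i hi)) hNG
        (by norm_num)).trans <| mul_le_mul_of_nonneg_right (by linarith) (sq_nonneg G)
  have hAz : vnorm (A.mulVec z) ^ 2 ≤ n * ε * vnorm z ^ 2 := by
    have h1 := vnorm_sq_sub_vnorm_sq V A z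
    rw [hVz, (vnorm_eq_zero 0).2 rfl] at h1
    have h2 : vnorm (A.mulVec z) ^ 2
        = ∑ i, ∑ k, z i * z k * ((A.transpose * A) i k - (V.transpose * V) i k) := by
      rw [show vnorm (A.mulVec z) ^ 2 = -(0 ^ 2 - vnorm (A.mulVec z) ^ 2) by ring, h1]
      simp only [← Finset.sum_neg_distrib, ← mul_neg, neg_sub]
    rw [h2]
    refine sum_sum_mul_le hε fun i k hi hk => ?_
    by_cases hij : i = j
    · by_cases hkj : k = j
      · rw [hij, hkj, hzj]
        have := (hV.err_zero j hj0).trans (err_bound_le (c := 1.03) (d := 1.03) hA hNG hNG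
          (by norm_num))
        have h4 : (gA + 1.03 * 1.03 * gB) * G ^ 2 ≤ ε :=
          mul_le_mul_of_nonneg_right (by linarith) (sq_nonneg G)
        simpa using this.trans h4
      · refine mul_mul_le_of_abs_le ?_
        rw [hij, abs_sub_comm, transpose_mul_self_comm V, transpose_mul_self_comm A]
        exact hmix k (hzle k hk hkj)
    · by_cases hkj : k = j
      · refine mul_mul_le_of_abs_le ?_
        rw [hkj, abs_sub_comm]
        exact hmix i (hzle i hi hij)
      · refine mul_mul_le_of_abs_le ?_
        rw [abs_sub_comm]
        exact (hV.abs_err_le hA (ih i (hzle i hi hij)) (ih k (hzle k hk hkj))).trans hε1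
  have h1 : n * ε * vnorm z ^ 2 ≤ 0.03 * σ ^ 2 * vnorm z ^ 2 :=
    mul_le_mul_of_nonneg_right hA.sq_le (sq_nonneg _)
  have h2 := pow_le_pow_left₀ (mul_nonneg hσ.le (vnorm_nonneg z)) (hA.le_mulVec z) 2
  have h3 : (σ * vnorm z) ^ 2 ≤ 0 := by nlinarith
  have h4 : σ * vnorm z = 0 := pow_eq_zero_iff two_ne_zero |>.1 (le_antisymm h3 (sq_nonneg _))
  have h5 : z = 0 := (vnorm_eq_zero z).1 ((mul_eq_zero.1 h4).resolve_left hσ.ne')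
  rw [h5] at hzj
  exact zero_ne_one hzj

theorem IsPerturbedCholesky.abs_vnorm_sq_sub_le (hV : IsPerturbedCholesky A V gA gB)
    (hA : IsWellConditioned A G σ gA gB) (z : Fin n → ℝ) :
    |vnorm (V.mulVec z) ^ 2 - vnorm (A.mulVec z) ^ 2| ≤ 0.03 * vnorm (A.mulVec z) ^ 2 := by
  have hgB := hA.gB_nonneg
  have hgA := hA.gA_nonneg
  refine (CholQR.abs_vnorm_sq_sub_le (ε := (gA + 1.07 * gB) * G ^ 2) (by positivity)
    fun i k _ _ => (hV.abs_err_le hA (hV.diag_pos hA i) (hV.diag_pos hA k)).trans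
      (mul_le_mul_of_nonneg_right (by linarith) (sq_nonneg G))).trans ?_
  have h1 := pow_le_pow_left₀ (mul_nonneg hA.σ_pos.le (vnorm_nonneg z)) (hA.le_mulVec z) 2
  have h2 := mul_le_mul_of_nonneg_right hA.sq_le (sq_nonneg (vnorm z))
  nlinarith

theorem IsPerturbedCholesky.frobNorm_err_le (hV : IsPerturbedCholesky A V gA gB)
    (hA : IsWellConditioned A G σ gA gB) :
    frobNorm (V.transpose * V - A.transpose * A) ≤ n * ((gA + 1.005 * gB) * G ^ 2) := by
  have hgB := hA.gB_nonneg
  have hgA := hA.gA_nonneg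
  exact frobNorm_le_of_abs_le_const (by positivity)
    fun i k => hV.abs_err_le hA (hV.diag_pos hA i) (hV.diag_pos hA k)

end Cholesky

/-! ### The orthogonal factor -/

section Solve

variable {m n : ℕ} {A : Matrix (Fin m) (Fin n) ℝ} {V : Matrix (Fin n) (Fin n) ℝ}
  {Q : Matrix (Fin m) (Fin n) ℝ} {G σ gA gB gC : ℝ}

theorem IsPerturbedCholesky.isUnit_det (hV : IsPerturbedCholesky A V gA gB)
    (hA : IsWellConditioned A G σ gA gB) : IsUnit V.det := by
  have htri : V.BlockTriangular id := fun i k hik => hV.upper i k hik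
  rw [Matrix.det_of_isUpperTriangular htri, isUnit_iff_ne_zero, Finset.prod_ne_zero_iff]
  exact fun i _ => (hV.diag_pos hA i).ne'

theorem IsPerturbedCholesky.vnorm_mulVec_bounds (hV : IsPerturbedCholesky A V gA gB)
    (hA : IsWellConditioned A G σ gA gB) (z : Fin n → ℝ) :
    0.985 * vnorm (V.mulVec z) ≤ vnorm (A.mulVec z) ∧
      vnorm (A.mulVec z) ≤ 1.0155 * vnorm (V.mulVec z) ∧
      vnorm (V.mulVec z) ≤ 1.015 * vnorm (A.mulVec z) := by
  have h := abs_le.1 (hV.abs_vnorm_sq_sub_le hA z)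
  have h1 := vnorm_nonneg (V.mulVec z)
  have h2 := vnorm_nonneg (A.mulVec z)
  refine ⟨abs_le_of_sq_le_sq' ?_ h2 |>.2, abs_le_of_sq_le_sq' ?_ (by positivity) |>.2,
    abs_le_of_sq_le_sq' ?_ (by positivity) |>.2⟩ <;>
  nlinarith [sq_nonneg (vnorm (V.mulVec z)), sq_nonneg (vnorm (A.mulVec z))]

theorem IsPerturbedCholesky.frobNorm_le (hV : IsPerturbedCholesky A V gA gB)
    (hA : IsWellConditioned A G σ gA gB) : frobNorm V ≤ √n * (1.002 * G) :=
  frobNorm_le_sqrt_mul (mul_nonneg (by norm_num) hA.G_nonneg)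
    fun j => hV.colNorm_le hA (hV.diag_pos hA j)

/-- `Q` is the result of a row-wise triangular solve with `V`, with relative error `gC`. -/
def IsPerturbedSolve (A : Matrix (Fin m) (Fin n) ℝ) (V : Matrix (Fin n) (Fin n) ℝ)
    (Q : Matrix (Fin m) (Fin n) ℝ) (gC : ℝ) : Prop :=
  ∀ i j, |(Q * V - A) i j| ≤ gC * ∑ k, |Q i k| * |V k j|

theorem IsPerturbedSolve.frobNorm_err_le_mul (hQ : IsPerturbedSolve A V Q gC) (hC : 0 ≤ gC)
    (hV : IsPerturbedCholesky A V gA gB) (hA : IsWellConditioned A G σ gA gB) :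
    frobNorm (Q * V - A) ≤ gC * (frobNorm Q * (√n * (1.002 * G))) :=
  (frobNorm_le_of_abs_le_sum hC hQ).trans <| mul_le_mul_of_nonneg_left
    (mul_le_mul_of_nonneg_left (hV.frobNorm_le hA) (frobNorm_nonneg Q)) hC

/-- The action of `Q` on a vector, compared with that of the exact quotient `A V⁻¹`. -/
theorem IsPerturbedSolve.abs_vnorm_sub_le (hQ : IsPerturbedSolve A V Q gC) (hC : 0 ≤ gC)
    (hV : IsPerturbedCholesky A V gA gB) (hA : IsWellConditioned A G σ gA gB)
    (y : Fin n → ℝ) :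
    0.985 * vnorm y - gC * (frobNorm Q * (√n * (1.002 * G))) * (1.0155 * vnorm y / σ)
        ≤ vnorm (Q.mulVec y) ∧
      vnorm (Q.mulVec y) ≤ 1.0155 * vnorm y
        + gC * (frobNorm Q * (√n * (1.002 * G))) * (1.0155 * vnorm y / σ) := by
  have hσ := hA.σ_pos
  set z := V⁻¹.mulVec y with hz
  have hVz : V.mulVec z = y := by
    rw [hz, Matrix.mulVec_mulVec, Matrix.mul_nonsing_inv _ (hV.isUnit_det hA),
      Matrix.one_mulVec]
  obtain ⟨h1, h2, -⟩ := hV.vnorm_mulVec_bounds hA z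
  rw [hVz] at h1 h2
  have h3 : vnorm z ≤ 1.0155 * vnorm y / σ := by
    rw [le_div_iff₀ hσ, mul_comm]
    exact (hA.le_mulVec z).trans h2
  have h4 : vnorm ((Q * V - A).mulVec z)
      ≤ gC * (frobNorm Q * (√n * (1.002 * G))) * (1.0155 * vnorm y / σ) :=
    (vnorm_mulVec_le_frobNorm_mul _ z).trans <|
      mul_le_mul (hQ.frobNorm_err_le_mul hC hV hA) h3 (vnorm_nonneg z)
        ((frobNorm_nonneg _).trans (hQ.frobNorm_err_le_mul hC hV hA))
  have h5 : Q.mulVec y = A.mulVec z + (Q * V - A).mulVec z := by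
    rw [Matrix.sub_mulVec, ← Matrix.mulVec_mulVec, hVz]
    abel
  have h6 : A.mulVec z = Q.mulVec y + -(Q * V - A).mulVec z := by
    rw [h5]
    abel
  have h7 := vnorm_add_le (A.mulVec z) ((Q * V - A).mulVec z)
  rw [← h5] at h7
  have h8 := vnorm_add_le (Q.mulVec y) (-(Q * V - A).mulVec z)
  rw [← h6, vnorm_neg] at h8
  constructor <;> linarith

theorem IsPerturbedSolve.frobNorm_le (hQ : IsPerturbedSolve A V Q gC) (hC : 0 ≤ gC)
    (hV : IsPerturbedCholesky A V gA gB) (hA : IsWellConditioned A G σ gA gB)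
    (hCG : n * gC * G ≤ 0.003 * σ) : frobNorm Q ≤ 1.02 * √n := by
  have hσ := hA.σ_pos
  have hG := hA.G_nonneg
  have hM := frobNorm_nonneg Q
  set M := frobNorm Q with hMdef
  set t := gC * (M * (√n * (1.002 * G))) * (1.0155 / σ) with ht
  have ht0 : 0 ≤ t := by positivity
  have hcol : ∀ j, colNorm Q j ≤ 1.0155 + t := by
    intro j
    have := (hQ.abs_vnorm_sub_le hC hV hA (Pi.single j 1)).2
    rw [vnorm_single, mul_one] at this
    rwa [colNorm_eq_vnorm_mulVec]
  have h1 : M ≤ √n * (1.0155 + t) := frobNorm_le_sqrt_mul (by positivity) hcol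
  have h2 : √n * t ≤ 0.0031 * M := by
    have h3 : √(n : ℝ) * √n = n := Real.mul_self_sqrt (Nat.cast_nonneg n)
    calc √n * t = (√n * √n) * gC * G * (M * 1.002 * 1.0155 / σ) := by rw [ht]; ring
      _ ≤ 0.003 * σ * (M * 1.002 * 1.0155 / σ) := by
          rw [h3]
          exact mul_le_mul_of_nonneg_right hCG (by positivity)
      _ = 0.003 * 1.002 * 1.0155 * M := by field_simp
      _ ≤ 0.0031 * M := by nlinarith
  nlinarith [Real.sqrt_nonneg (n : ℝ)]

/-- The solve with the perturbed Cholesky factor yields a nearly orthogonal matrix. -/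
theorem IsPerturbedSolve.vnorm_mulVec_bounds (hQ : IsPerturbedSolve A V Q gC) (hC : 0 ≤ gC)
    (hV : IsPerturbedCholesky A V gA gB) (hA : IsWellConditioned A G σ gA gB)
    (hCG : n * gC * G ≤ 0.003 * σ) (y : Fin n → ℝ) :
    0.98 * vnorm y ≤ vnorm (Q.mulVec y) ∧ vnorm (Q.mulVec y) ≤ 1.02 * vnorm y := by
  have hσ := hA.σ_pos
  have hG := hA.G_nonneg
  have hy := vnorm_nonneg y
  have h1 : gC * (frobNorm Q * (√n * (1.002 * G))) * (1.0155 * vnorm y / σ) ≤ 0.004 * vnorm y := by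
    have h3 : √(n : ℝ) * √n = n := Real.mul_self_sqrt (Nat.cast_nonneg n)
    calc gC * (frobNorm Q * (√n * (1.002 * G))) * (1.0155 * vnorm y / σ)
        ≤ gC * (1.02 * √n * (√n * (1.002 * G))) * (1.0155 * vnorm y / σ) := by
          have := hQ.frobNorm_le hC hV hA hCG
          gcongr
      _ = (√n * √n) * gC * G * (1.02 * 1.002 * 1.0155 * vnorm y / σ) := by ring
      _ ≤ 0.003 * σ * (1.02 * 1.002 * 1.0155 * vnorm y / σ) := by
          rw [h3]
          exact mul_le_mul_of_nonneg_right hCG (by positivity)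
      _ = 0.003 * 1.02 * 1.002 * 1.0155 * vnorm y := by field_simp
      _ ≤ 0.004 * vnorm y := by nlinarith
  obtain ⟨h2, h3⟩ := hQ.abs_vnorm_sub_le hC hV hA y
  constructor <;> linarith

theorem IsPerturbedSolve.frobNorm_err_le (hQ : IsPerturbedSolve A V Q gC) (hC : 0 ≤ gC)
    (hV : IsPerturbedCholesky A V gA gB) (hA : IsWellConditioned A G σ gA gB)
    (hCG : n * gC * G ≤ 0.003 * σ) : frobNorm (Q * V - A) ≤ 1.0221 * (n * gC * G) := by
  have hG := hA.G_nonneg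
  have h3 : √(n : ℝ) * √n = n := Real.mul_self_sqrt (Nat.cast_nonneg n)
  calc frobNorm (Q * V - A) ≤ gC * (frobNorm Q * (√n * (1.002 * G))) :=
        hQ.frobNorm_err_le_mul hC hV hA
    _ ≤ gC * (1.02 * √n * (√n * (1.002 * G))) := by
        have := hQ.frobNorm_le hC hV hA hCG
        gcongr
    _ = 1.02 * 1.002 * (√n * √n * gC * G) := by ring
    _ ≤ 1.0221 * (n * gC * G) := by
        rw [h3]
        exact mul_le_mul_of_nonneg_right (by norm_num) (by positivity)

/-- Loss of orthogonality of the quotient, by the congruence of `Qᵀ Q - I` with `V`. -/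
theorem IsPerturbedSolve.frobNorm_orth_le {e c : ℝ} (hQ : IsPerturbedSolve A V Q gC) (hC : 0 ≤ gC)
    (hV : IsPerturbedCholesky A V gA gB) (hA : IsWellConditioned A G σ gA gB)
    (hCG : n * gC * G ≤ 0.003 * σ) (he : 1.0221 * (n * gC * G) ≤ e)
    (hσ : 0.98 ≤ σ) (hc : specNorm A ≤ c) :
    frobNorm (Q.transpose * Q - 1)
      ≤ 1.075 * (2 * c * e + e ^ 2 + n * ((gA + 1.005 * gB) * G ^ 2)) := by
  set E := Q * V - A with hE
  have hEe : frobNorm E ≤ e := (hQ.frobNorm_err_le hC hV hA hCG).trans he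
  have hE0 := frobNorm_nonneg E
  have hdet := hV.isUnit_det hA
  have hQV : Q * V = A + E := by rw [hE]; abel
  set Z := A.transpose * E + E.transpose * A + E.transpose * E
    - (V.transpose * V - A.transpose * A) with hZ
  have hcong : V.transpose * (Q.transpose * Q - 1) * V = Z := by
    have h1 : V.transpose * (Q.transpose * Q - 1) * V = (Q * V).transpose * (Q * V)
        - V.transpose * V := by
      rw [Matrix.mul_sub, Matrix.sub_mul, Matrix.mul_one, Matrix.transpose_mul]
      simp only [Matrix.mul_assoc]
    rw [h1, hQV, Matrix.transpose_add, Matrix.add_mul, Matrix.mul_add, Matrix.mul_add, hZ]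
    abel
  have hX : Q.transpose * Q - 1 = V⁻¹.transpose * Z * V⁻¹ := by
    rw [← hcong, Matrix.mul_assoc V.transpose, ← Matrix.mul_assoc V⁻¹.transpose,
      ← Matrix.transpose_mul, Matrix.mul_nonsing_inv _ hdet, Matrix.transpose_one, Matrix.one_mul,
      Matrix.mul_assoc, Matrix.mul_nonsing_inv _ hdet, Matrix.mul_one]
  have hWn : specNorm V⁻¹ ≤ 1.0155 / 0.98 := by
    refine specNorm_le (by norm_num) fun y => ?_
    have hVz : V.mulVec (V⁻¹.mulVec y) = y := by
      rw [Matrix.mulVec_mulVec, Matrix.mul_nonsing_inv _ hdet, Matrix.one_mulVec]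
    have h1 := (hV.vnorm_mulVec_bounds hA (V⁻¹.mulVec y)).2.1
    have h2 := hA.le_mulVec (V⁻¹.mulVec y)
    have h3 := mul_le_mul_of_nonneg_right hσ (vnorm_nonneg (V⁻¹.mulVec y))
    rw [hVz] at h1
    rw [div_mul_eq_mul_div, le_div_iff₀ (by norm_num)]
    linarith
  have hc0 : 0 ≤ c := (specNorm_nonneg A).trans hc
  have hZn : frobNorm Z ≤ 2 * c * e + e ^ 2 + n * ((gA + 1.005 * gB) * G ^ 2) := by
    have h1 : frobNorm (A.transpose * E) ≤ c * e :=
      (frobNorm_mul_le_specNorm_mul _ _).trans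
        (mul_le_mul (by rwa [specNorm_transpose]) hEe hE0 hc0)
    have h2 : frobNorm (E.transpose * A) ≤ c * e := by
      rw [← frobNorm_transpose, Matrix.transpose_mul, Matrix.transpose_transpose]
      exact h1
    have h3 : frobNorm (E.transpose * E) ≤ e ^ 2 := by
      refine (frobNorm_mul_le _ _).trans ?_
      rw [frobNorm_transpose, sq]
      exact mul_le_mul hEe hEe hE0 (hE0.trans hEe)
    have h4 := hV.frobNorm_err_le hA
    have h5 := frobNorm_sub_le (A.transpose * E + E.transpose * A + E.transpose * E)
      (V.transpose * V - A.transpose * A)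
    have h6 := frobNorm_add_le (A.transpose * E + E.transpose * A) (E.transpose * E)
    have h7 := frobNorm_add_le (A.transpose * E) (E.transpose * A)
    linarith
  have hZ0 := frobNorm_nonneg Z
  have hW0 := specNorm_nonneg V⁻¹
  calc frobNorm (Q.transpose * Q - 1) ≤ specNorm V⁻¹ * frobNorm Z * specNorm V⁻¹ := by
        rw [hX]
        refine (frobNorm_mul_le_mul_specNorm _ _).trans (mul_le_mul_of_nonneg_right ?_ hW0)
        simpa only [specNorm_transpose] using frobNorm_mul_le_specNorm_mul V⁻¹.transpose Z
    _ ≤ 1.0155 / 0.98 * frobNorm Z * (1.0155 / 0.98) := by gcongr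
    _ ≤ 1.075 * frobNorm Z := by nlinarith
    _ ≤ _ := by gcongr

end Solve

/-! ### One run of CholeskyQR under bounded accumulated errors -/

section Below

variable {n : ℕ}

theorem sum_below (j : Fin n) (g : Fin n → ℝ) (S : Finset (Fin n)) (T : Finset (Fin j.val))
    (h : ∀ l, l ∈ S ↔ ∃ h : l < j, (⟨l.val, h⟩ : Fin j.val) ∈ T) :
    ∑ l ∈ T, g (below j l) = ∑ l ∈ S, g l := by
  refine Finset.sum_nbij (below j) (fun l hl => (h _).2 ⟨l.isLt, hl⟩) ?_ ?_ fun _ _ => rfl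
  · intro a _ b _ hab
    exact Fin.ext (congrArg Fin.val hab :)
  · intro l hl
    obtain ⟨hlj, hl⟩ := (h l).1 hl
    exact ⟨_, hl, rfl⟩

theorem sum_eq_add_sum_below (j : Fin n) (g : Fin n → ℝ) (hg : ∀ k, j < k → g k = 0) :
    ∑ k, g k = g j + ∑ k : Fin j.val, g (below j k) := by
  rw [sum_below j g {l | l < j} Finset.univ (by simp),
    ← Finset.sum_subset (Finset.subset_univ (Finset.univ.filter (· ≤ j)))]
  · rw [show Finset.univ.filter (· ≤ j) = insert j (Finset.univ.filter (· < j)) by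
      ext l; simp [le_iff_eq_or_lt], Finset.sum_insert (by simp)]
  · intro k _ hk
    exact hg k (by simpa using hk)

theorem abs_sum_below_le {j : Fin n} {f : Fin n → ℝ} {B : ℝ} (hB : 0 ≤ B)
    (h : ∀ k < j, |∑ l with l ≤ k, f l| ≤ B) (r : ℕ) :
    |∑ l : Fin j.val with l.val < r, f (below j l)| ≤ B := by
  by_cases hr : r = 0 ∨ j.val = 0
  · rw [Finset.sum_eq_zero]
    · simpa
    · intro l hl
      have h1 := l.isLt
      have h2 := (Finset.mem_filter.1 hl).2
      omega
  · have hlt : min r j.val - 1 < j.val := by omega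
    set k : Fin n := ⟨min r j.val - 1, hlt.trans j.isLt⟩ with hk
    rw [sum_below j f {l | l ≤ k}]
    · exact h k hlt
    · intro l
      simp only [Finset.mem_filter, Finset.mem_univ, true_and, exists_prop, Fin.le_def,
        Fin.lt_def, hk]
      omega

end Below

theorem abs_add_sum_sub_le {i : ℕ} {p q w₀ b U : ℝ} {x y w : Fin i → ℝ} (h₀ : Near b w₀)
    (hw : ∀ k, Near b (w k)) (hU : U = p * q * w₀ + ∑ k, x k * y k * w k) :
    |p * q + ∑ k, x k * y k - U| ≤ (Real.exp b - 1) * (|p| * |q| + ∑ k, |x k| * |y k|) := by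
  have h1 := abs_sum_mul_sub_le Finset.univ x y w fun k _ => hw k
  have h2 : |p * q * (w₀ - 1)| ≤ (Real.exp b - 1) * (|p| * |q|) := by
    rw [abs_mul, abs_mul, mul_comm]
    exact mul_le_mul_of_nonneg_right h₀.abs_sub_one_le (by positivity)
  rw [abs_sub_comm, hU, mul_add]
  refine le_trans ?_ (add_le_add h2 h1)
  refine le_trans (le_of_eq ?_) (abs_add_le _ _)
  congr 1
  ring

variable {m n : ℕ}

/-- The accumulated errors in one run of CholeskyQR are bounded: every error by `u`, the sums of
the errors of the additions that follow a given product of an inner product in the Gram matrix by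
`Bm`, and the sums of the errors of the first subtractions in an entry of the Cholesky factor or of
a triangular solve by `Bn`. -/
structure ErrorsBounded (u Bm Bn : ℝ) (e : StepOp m n → ℝ) : Prop where
  bound : ∀ o, |e o| ≤ u
  gram : ∀ i j, i ≤ j → ∀ r, |∑ l with r ≤ l ∧ 0 < l.val, e (.gramAdd i j l)| ≤ Bm
  chol : ∀ i j, i ≤ j → ∀ k < i, |∑ l with l ≤ k, e (.cholSub i j l)| ≤ Bn
  solve : ∀ i j, ∀ k < j, |∑ l with l ≤ k, e (.solveSub i j l)| ≤ Bn

section Step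

variable {A : Matrix (Fin m) (Fin n) ℝ} {e : StepOp m n → ℝ} {u Bm Bn gA gB gC : ℝ}

theorem ErrorsBounded.abs_stepU_sub_le (he : ErrorsBounded u Bm Bn e) (hu0 : 0 ≤ u)
    (hu : u ≤ 1 / 2) (hBm : 0 ≤ Bm)
    (hgA : Real.exp (Bm + u + 2 * (m + 1) * u ^ 2) - 1 ≤ gA) {i j : Fin n} (hij : i ≤ j) :
    |stepU A e i j - (A.transpose * A) i j| ≤ gA * (colNorm A i * colNorm A j) := by
  obtain ⟨w, hw, hU⟩ := exists_flDot_eq (fun k => A k i) (fun k => A k j)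
    (fun k => e (.gramMul i j k)) (fun k => e (.gramAdd i j k)) hu (fun _ => he.bound _)
    (fun _ => he.bound _) (he.gram i j hij)
  have h1 := abs_sum_mul_sub_le Finset.univ (fun k => A k i) (fun k => A k j) w fun k _ => hw k
  rw [← hU] at h1
  have h2 := sum_abs_mul_le_vnorm_mul (fun k => A k i) (fun k => A k j)
  rw [Matrix.mul_apply]
  exact h1.trans (mul_le_mul hgA h2 (by positivity)
    ((sub_nonneg.2 (Real.one_le_exp (by positivity))).trans hgA))

theorem stepV_of_lt {i j : Fin n} (h : j < i) : stepV A e i j = 0 := by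
  rw [stepV, Matrix.of_apply, flChol, dif_pos h]

theorem stepV_diag (j : Fin n) : stepV A e j j
    = √(flPivot (stepU A e) (fun i j k => e (.cholMul i j k)) (fun i j k => e (.cholSub i j k))
        (fun i j => e (.cholFin i j)) j) * (1 + e (.cholFin j j)) := by
  rw [stepV, Matrix.of_apply, flChol, dif_neg (lt_irrefl j), dif_pos rfl]
  rfl

theorem ErrorsBounded.exists_stepU_eq (he : ErrorsBounded u Bm Bn e) (hu : u ≤ 1 / 2)
    (hBn : 0 ≤ Bn) {i j : Fin n} (hij : i ≤ j) :
    ∃ (w₀ : ℝ) (w : Fin i.val → ℝ), Near (Bn + 2 * i * u ^ 2) w₀ ∧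
      (∀ k, Near (Bn + u + 2 * (i + 1) * u ^ 2) (w k)) ∧
      stepU A e i j = flSubDot (stepU A e i j) i.val
        (fun k => stepV A e (below i k) i) (fun k => stepV A e (below i k) j)
        (fun k => e (.cholMul i j (below i k))) (fun k => e (.cholSub i j (below i k))) * w₀
        + ∑ k, stepV A e (below i k) i * stepV A e (below i k) j * w k :=
  exists_flSubDot_eq _ _ _ _ _ hu (fun _ => he.bound _) (fun _ => he.bound _)
    (abs_sum_below_le hBn (he.chol i j hij))

/-- The computed Cholesky factor of a computed Gram matrix. -/
theorem ErrorsBounded.isPerturbedCholesky (he : ErrorsBounded u Bm Bn e) (hu0 : 0 ≤ u)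
    (hu : u ≤ 1 / 2)
    (hBm : 0 ≤ Bm) (hBn : 0 ≤ Bn) (hgA : Real.exp (Bm + u + 2 * (m + 1) * u ^ 2) - 1 ≤ gA)
    (hgB : Real.exp (Bn + 2 * u + 2 * (n + 1) * u ^ 2) - 1 ≤ gB) :
    IsPerturbedCholesky A (stepV A e) gA gB := by
  set V := stepV A e with hVdef
  have hup : ∀ k j, j < k → V k j = 0 := fun k j h => stepV_of_lt h
  have h1e : ∀ o, 0 < 1 + e o := fun o => by linarith [(abs_le.1 (he.bound o)).1]
  have hin : ∀ i : Fin n, (i : ℝ) + 1 ≤ n := fun i => by exact_mod_cast i.isLt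
  have hu2 := sq_nonneg u
  have hb : ∀ i : Fin n, Bn + 2 * i * u ^ 2 + (u + 2 * u ^ 2) + (u + 2 * u ^ 2)
      ≤ Bn + 2 * u + 2 * (n + 1) * u ^ 2 := fun i => by
    nlinarith [mul_le_mul_of_nonneg_right (hin i) hu2]
  have hb' : ∀ i : Fin n, Bn + u + 2 * (i + 1) * u ^ 2 ≤ Bn + 2 * u + 2 * (n + 1) * u ^ 2 :=
    fun i => by nlinarith [mul_le_mul_of_nonneg_right (hin i) hu2]
  have hexp : 0 ≤ Real.exp (Bn + 2 * u + 2 * (n + 1) * u ^ 2) - 1 :=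
    sub_nonneg.2 (Real.one_le_exp (by positivity))
  have hsum : ∀ i j, (V.transpose * V) i j
      = V i i * V i j + ∑ k : Fin i.val, V (below i k) i * V (below i k) j := fun i j => by
    rw [Matrix.mul_apply]
    exact sum_eq_add_sum_below i (fun k => V k i * V k j) fun k hk => by rw [hup k i hk, zero_mul]
  have habs : ∀ i j, |V i i| * |V i j| + ∑ k : Fin i.val, |V (below i k) i| * |V (below i k) j|
      ≤ colNorm V i * colNorm V j := fun i j => by
    rw [← sum_eq_add_sum_below i (fun k => |V k i| * |V k j|) fun k hk => by
      rw [hup k i hk, abs_zero, zero_mul]]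
    exact sum_abs_mul_le_vnorm_mul (fun k => V k i) (fun k => V k j)
  refine ⟨hup, fun j => ?_, fun i j hij hVi => ?_, fun j hj => ?_⟩
  · rw [hVdef, stepV_diag]
    exact mul_nonneg (Real.sqrt_nonneg _) (h1e _).le
  · obtain ⟨w₀, w, hw₀, hw, hU⟩ := he.exists_stepU_eq (A := A) hu hBn hij
    have hkey : ∃ w₁, Near (Bn + 2 * u + 2 * (n + 1) * u ^ 2) w₁ ∧ stepU A e i j
        = V i i * V i j * w₁ + ∑ k, V (below i k) i * V (below i k) j * w k := by
      have hne := (near_one_add hu (he.bound (.cholFin i j))).inv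
      rcases hij.eq_or_lt with rfl | hlt
      · refine ⟨w₀ * (1 + e (.cholFin i i))⁻¹ * (1 + e (.cholFin i i))⁻¹,
          ((hw₀.mul hne).mul hne).mono (hb i), ?_⟩
        rw [hU]
        congr 1
        have hd := stepV_diag (A := A) (e := e) i
        set S := flPivot (stepU A e) (fun i j k => e (.cholMul i j k))
          (fun i j k => e (.cholSub i j k)) (fun i j => e (.cholFin i j)) i with hS
        have hS0 : 0 < S := by
          by_contra h
          rw [Real.sqrt_eq_zero_of_nonpos (not_lt.1 h), zero_mul] at hd
          exact hVi.ne' hd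
        have hVV : V i i * V i i = S * ((1 + e (.cholFin i i)) * (1 + e (.cholFin i i))) := by
          rw [hVdef, hd]
          nlinarith [Real.mul_self_sqrt hS0.le]
        rw [hVV]
        have := (h1e (.cholFin i i)).ne'
        change S * w₀ = _
        field_simp
      · refine ⟨w₀ * (1 + e (.cholFin i j))⁻¹,
          (hw₀.mul hne).mono (le_trans (by nlinarith) (hb i)), ?_⟩
        rw [hU]
        congr 1
        have hd : V i j = flSubDot (stepU A e i j) i.val
            (fun k => V (below i k) i) (fun k => V (below i k) j)
            (fun k => e (.cholMul i j (below i k))) (fun k => e (.cholSub i j (below i k)))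
            / V i i * (1 + e (.cholFin i j)) := by
          rw [hVdef, stepV, Matrix.of_apply, flChol, dif_neg hlt.le.not_gt, dif_neg hlt.ne]
          rfl
        rw [hd]
        have := (h1e (.cholFin i j)).ne'
        have := hVi.ne'
        field_simp
        exact mul_comm _ _
    obtain ⟨w₁, hw₁, hU⟩ := hkey
    have h1 := abs_add_sum_sub_le hw₁ (fun k => (hw k).mono (hb' i)) hU
    rw [← hsum] at h1
    have h2 := h1.trans (mul_le_mul hgB (habs i j) (by positivity) (hexp.trans hgB))
    have h3 := he.abs_stepU_sub_le (A := A) hu0 hu hBm hgA hij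
    have h4 := abs_sub_le ((V.transpose * V) i j) (stepU A e i j) ((A.transpose * A) i j)
    linarith
  · obtain ⟨w₀, w, hw₀, hw, hU⟩ := he.exists_stepU_eq (A := A) hu hBn (le_refl j)
    have hS : flPivot (stepU A e) (fun i j k => e (.cholMul i j k))
          (fun i j k => e (.cholSub i j k)) (fun i j => e (.cholFin i j)) j ≤ 0 := by
      by_contra h
      have hd := stepV_diag (A := A) (e := e) j
      rw [← hVdef, hj] at hd
      exact (mul_pos (Real.sqrt_pos.2 (not_le.1 h)) (h1e _)).ne hd
    have hU' : stepU A e j j ≤ ∑ k, V (below j k) j * V (below j k) j * w k := by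
      rw [hU]
      have := mul_nonpos_of_nonpos_of_nonneg hS hw₀.pos.le
      exact add_le_of_nonpos_left this
    have h1 := abs_add_sum_sub_le (p := V j j) (q := V j j) (w₀ := 1)
      (x := fun k => V (below j k) j) (y := fun k => V (below j k) j)
      (b := Bn + 2 * u + 2 * (n + 1) * u ^ 2)
      ⟨Real.exp_le_one_iff.2 (neg_nonpos.2 (by positivity)), Real.one_le_exp (by positivity)⟩
      (fun k => (hw k).mono (hb' j)) rfl
    rw [← hsum] at h1
    have h2 := h1.trans (mul_le_mul hgB (habs j j) (by positivity) (hexp.trans hgB))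
    have h3 := he.abs_stepU_sub_le (A := A) hu0 hu hBm hgA (le_refl j)
    rw [hj] at h2
    have := (abs_le.1 h2).1
    have := (abs_le.1 h3).1
    linarith

theorem ErrorsBounded.isPerturbedSolve (he : ErrorsBounded u Bm Bn e)
    (hu : u ≤ 1 / 2) (hBn : 0 ≤ Bn) (hgC : Real.exp (Bn + u + 2 * (n + 1) * u ^ 2) - 1 ≤ gC)
    (hV : ∀ j, stepV A e j j ≠ 0) :
    IsPerturbedSolve A (stepV A e) (stepQ A e) gC := by
  intro i j
  set V := stepV A e with hVdef
  set Q := stepQ A e with hQdef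
  have hu2 := sq_nonneg u
  have hjn : (j : ℝ) + 1 ≤ n := by exact_mod_cast j.isLt
  have h1e : 0 < 1 + e (.solveDiv i j) := by linarith [(abs_le.1 (he.bound (.solveDiv i j))).1]
  obtain ⟨w₀, w, hw₀, hw, hA⟩ := exists_flSubDot_eq (A i j) (fun k => Q i (below j k))
    (fun k => V (below j k) j) (fun k => e (.solveMul i j (below j k)))
    (fun k => e (.solveSub i j (below j k))) hu (fun _ => he.bound _) (fun _ => he.bound _)
    (abs_sum_below_le hBn (he.solve i j))
  have hd : Q i j = flSubDot (A i j) j.val (fun k => Q i (below j k))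
      (fun k => V (below j k) j) (fun k => e (.solveMul i j (below j k)))
      (fun k => e (.solveSub i j (below j k))) / V j j * (1 + e (.solveDiv i j)) := by
    rw [hQdef, stepQ, Matrix.of_apply, flSolve]
    rfl
  have hA' : A i j = Q i j * V j j * (w₀ * (1 + e (.solveDiv i j))⁻¹)
      + ∑ k, Q i (below j k) * V (below j k) j * w k := by
    conv_lhs => rw [hA]
    congr 1
    rw [hd]
    have := h1e.ne'
    have := hV j
    field_simp
  have h1 := abs_add_sum_sub_le (b := Bn + u + 2 * (n + 1) * u ^ 2)
    ((hw₀.mul (near_one_add hu (he.bound (.solveDiv i j))).inv).mono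
      (by nlinarith [mul_le_mul_of_nonneg_right hjn hu2]))
    (fun k => (hw k).mono (by nlinarith [mul_le_mul_of_nonneg_right hjn hu2])) hA'
  have hup : ∀ k, j < k → V k j = 0 := fun k hk => stepV_of_lt hk
  rw [← sum_eq_add_sum_below j (fun k => Q i k * V k j) fun k hk => by rw [hup k hk, mul_zero],
    ← sum_eq_add_sum_below j (fun k => |Q i k| * |V k j|) fun k hk => by
      rw [hup k hk, abs_zero, mul_zero]] at h1
  rw [Matrix.sub_apply, Matrix.mul_apply]
  exact h1.trans (mul_le_mul_of_nonneg_right hgC (by positivity))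

theorem stepCompletes_of_diag_pos (hV : ∀ j, 0 < stepV A e j j) : StepCompletes A e := by
  intro j
  by_contra h
  have hd := stepV_diag (A := A) (e := e) j
  rw [Real.sqrt_eq_zero_of_nonpos (not_lt.1 h), zero_mul] at hd
  exact (hV j).ne' hd

end Step

/-- A rounded product of square matrices. -/
theorem abs_flMul_sub_le {A B : Matrix (Fin n) (Fin n) ℝ} {δ η : Fin n → Fin n → Fin n → ℝ}
    {u Bn g : ℝ} (hu : u ≤ 1 / 2) (hδ : ∀ i j k, |δ i j k| ≤ u) (hη : ∀ i j k, |η i j k| ≤ u)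
    (hB : ∀ i j (r : Fin n), |∑ l with r ≤ l ∧ 0 < l.val, η i j l| ≤ Bn)
    (hg : Real.exp (Bn + u + 2 * (n + 1) * u ^ 2) - 1 ≤ g) (i j : Fin n) :
    |(flMul A B δ η - A * B) i j| ≤ g * ∑ k, |A i k| * |B k j| := by
  obtain ⟨w, hw, hU⟩ := exists_flDot_eq (fun k => A i k) (fun k => B k j) (δ i j) (η i j) hu
    (hδ i j) (hη i j) (hB i j)
  have h1 := abs_sum_mul_sub_le Finset.univ (fun k => A i k) (fun k => B k j) w fun k _ => hw k
  rw [← hU] at h1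
  rw [Matrix.sub_apply, Matrix.mul_apply]
  exact h1.trans (mul_le_mul_of_nonneg_right hg (by positivity))

/-! ### CholeskyQR2 under bounded accumulated errors -/

theorem exp_sub_one_le {b x c d : ℝ} (hb : b ≤ c * x) (hc : 0 ≤ c * x) (hx : c * x ≤ 1 / 1000)
    (hd : 1.001 * (c * x) ≤ d * x) : Real.exp b - 1 ≤ d * x := by
  have h1 := Real.abs_exp_sub_one_sub_id_le (x := c * x) (by rw [abs_of_nonneg hc]; linarith)
  have h2 := (abs_le.1 h1).2
  have h3 := Real.exp_le_exp.2 hb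
  nlinarith

/-- Cauchy–Schwarz: a few deterministically bounded errors `q r` beside a sum bounded by `l √p` only
increase the constant, since `l` is bounded below. -/
theorem mul_sqrt_add_mul_le {l p q r s d : ℝ} (hl : 0 ≤ l) (hd : 0 ≤ d) (hp : 0 ≤ p) (hs : 0 ≤ s)
    (hps : p + r ^ 2 = s) (h : l ^ 2 + q ^ 2 ≤ d ^ 2 * l ^ 2) :
    l * √p + q * r ≤ d * (l * √s) := by
  refine abs_le_of_sq_le_sq' ?_ (by positivity) |>.2
  have h1 : (l * √p + q * r) ^ 2 ≤ (l ^ 2 + q ^ 2) * s := by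
    have := Real.sq_sqrt hp
    rw [← hps]
    nlinarith [sq_nonneg (l * r - q * √p)]
  have h2 := mul_le_mul_of_nonneg_right h hs
  have := Real.sq_sqrt hs
  calc _ ≤ _ := h1.trans h2
    _ = (d * (l * √s)) ^ 2 := by rw [mul_pow, mul_pow, this]; ring

/-- The conditions on the unit roundoff `u` and the confidence parameter `lam`. The lower bounds for
`lam` hold because it must make the probability `probQ u lam (m * n ^ 2)` positive. -/
structure SmallRoundoff (m n : ℕ) (u lam : ℝ) : Prop where
  u_pos : 0 < u
  one_le_m : 1 ≤ m
  one_le_n : 1 ≤ n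
  le_lam : 1.17 ≤ lam
  le_lam_of_two_le : 2 ≤ n → 2.3 ≤ lam
  m_prob : lam * √(m : ℝ) * n * u ≤ 1 / 2200
  m_det : m * n * u ≤ 1 / 2200
  n_prob : lam * √((n : ℝ) + 1) * n * u ≤ 1 / 2200
  n_det : ((n : ℝ) + 1) * n * u ≤ 1 / 2200

namespace SmallRoundoff

variable {m n : ℕ} {u lam : ℝ}

theorem lam_pos (h : SmallRoundoff m n u lam) : 0 < lam := by linarith [h.le_lam]

theorem one_le_n_real (h : SmallRoundoff m n u lam) : (1 : ℝ) ≤ n := by exact_mod_cast h.one_le_n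

theorem one_le_m_real (h : SmallRoundoff m n u lam) : (1 : ℝ) ≤ m := by exact_mod_cast h.one_le_m

theorem u_le (h : SmallRoundoff m n u lam) : u ≤ 1 / 2200 := by
  have h1 := h.one_le_n_real
  have h2 := h.one_le_m_real
  have : 1 * 1 * u ≤ m * n * u :=
    mul_le_mul_of_nonneg_right (mul_le_mul h2 h1 zero_le_one (by linarith)) h.u_pos.le
  linarith [h.m_det]

theorem succ_mul_u_le (h : SmallRoundoff m n u lam) : ((n : ℝ) + 1) * u ≤ 1 / 2200 := by
  have h1 := mul_le_mul_of_nonneg_left h.one_le_n_real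
    (mul_nonneg (by positivity : 0 ≤ (n : ℝ) + 1) h.u_pos.le)
  linarith [h.n_det]

theorem u_le_of_one_le (h : SmallRoundoff m n u lam) {k : ℝ} (hk : 1 ≤ k) : u ≤ lam * √k * u := by
  have h1 : 1 ≤ √k := Real.one_le_sqrt.2 hk
  have h2 : 1 ≤ lam := by linarith [h.le_lam]
  have := mul_le_mul_of_nonneg_right (one_le_mul_of_one_le_of_one_le h2 h1) h.u_pos.le
  linarith

/-- Relative error of the Gram matrix. -/
theorem exp_gram_le (h : SmallRoundoff m n u lam) :
    Real.exp (lam * √((m : ℝ) - 1) * u + u + 2 * (m + 1) * u ^ 2) - 1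
      ≤ 1.42 * (lam * √(m : ℝ) * u) := by
  have hu := h.u_pos
  have hm := h.one_le_m_real
  have hn := h.one_le_n_real
  have hl := h.le_lam
  have hx0 : 0 ≤ lam * √(m : ℝ) * u := by have := h.lam_pos; positivity
  have hx1 : lam * √(m : ℝ) * u ≤ 1 / 2200 := by
    have := mul_le_mul_of_nonneg_left hn hx0
    linarith [h.m_prob]
  have h1 := mul_sqrt_add_mul_le (l := lam) (p := m - 1) (q := 1) (r := 1) (s := m) (d := 1.4)
    h.lam_pos.le (by norm_num) (by linarith) (by linarith) (by ring) (by nlinarith)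
  have h2 : 2 * ((m : ℝ) + 1) * u ^ 2 ≤ 0.01 * u := by
    have h3 : (m : ℝ) * u ≤ 1 / 2200 := by
      have := mul_le_mul_of_nonneg_left hn (mul_nonneg (by linarith : (0 : ℝ) ≤ m) hu.le)
      linarith [h.m_det]
    nlinarith [h.u_le]
  have h4 := h.u_le_of_one_le hm
  refine exp_sub_one_le (c := 1.41) ?_ (by positivity) (by linarith) (by linarith)
  nlinarith [mul_le_mul_of_nonneg_right h1 hu.le]

/-- Relative error of the Cholesky factorization. -/
theorem exp_chol_le (h : SmallRoundoff m n u lam) :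
    Real.exp (lam * √((n : ℝ) - 1) * u + 2 * u + 2 * (n + 1) * u ^ 2) - 1
      ≤ 1.61 * (lam * √((n : ℝ) + 1) * u) := by
  have hu := h.u_pos
  have hn := h.one_le_n_real
  have hl := h.le_lam
  have hx0 : 0 ≤ lam * √((n : ℝ) + 1) * u := by have := h.lam_pos; positivity
  have hx1 : lam * √((n : ℝ) + 1) * u ≤ 1 / 2200 := by
    have := mul_le_mul_of_nonneg_left hn hx0
    linarith [h.n_prob]
  have h1 := mul_sqrt_add_mul_le (l := lam) (p := n - 1) (q := √2) (r := √2) (s := n + 1) (d := 1.6)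
    h.lam_pos.le (by norm_num) (by linarith) (by linarith)
    (by rw [Real.sq_sqrt zero_le_two]; ring) (by rw [Real.sq_sqrt zero_le_two]; nlinarith)
  rw [Real.mul_self_sqrt zero_le_two] at h1
  have h2 : 2 * ((n : ℝ) + 1) * u ^ 2 ≤ 0.001 * u := by
    nlinarith [h.succ_mul_u_le]
  have h4 := h.u_le_of_one_le (k := n + 1) (by linarith)
  refine exp_sub_one_le (c := 1.602) ?_ (by positivity) (by linarith) (by linarith)
  nlinarith [mul_le_mul_of_nonneg_right h1 hu.le]

/-- Relative error of the triangular solves and of the product of the triangular factors. -/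
theorem exp_solve_le (h : SmallRoundoff m n u lam) :
    Real.exp (lam * √((n : ℝ) - 1) * u + u + 2 * (n + 1) * u ^ 2) - 1
      ≤ 1.11 * (lam * √(n : ℝ) * u) := by
  have hu := h.u_pos
  have hn := h.one_le_n_real
  have hl := h.le_lam
  have hx0 : 0 ≤ lam * √(n : ℝ) * u := by have := h.lam_pos; positivity
  have hx1 : lam * √(n : ℝ) * u ≤ 1 / 2200 := by
    have h1 := mul_le_mul_of_nonneg_left hn hx0
    have h2 : lam * √(n : ℝ) * n * u ≤ lam * √((n : ℝ) + 1) * n * u := by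
      have := h.lam_pos
      have : √(n : ℝ) ≤ √((n : ℝ) + 1) := Real.sqrt_le_sqrt (by linarith)
      gcongr
    linarith [h.n_prob]
  have h1 : lam * √((n : ℝ) - 1) + 1 ≤ 1.1 * (lam * √(n : ℝ)) := by
    rcases h.one_le_n.eq_or_lt with h1 | h1
    · rw [← h1]
      norm_num
      linarith
    · have h2 := h.le_lam_of_two_le h1
      have := mul_sqrt_add_mul_le (l := lam) (p := n - 1) (q := 1) (r := 1) (s := n) (d := 1.1)
        h.lam_pos.le (by norm_num) (by linarith) (by linarith) (by ring) (by nlinarith)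
      linarith
  have h2 : 2 * ((n : ℝ) + 1) * u ^ 2 ≤ 0.001 * u := by
    nlinarith [h.succ_mul_u_le]
  have h4 := h.u_le_of_one_le hn
  refine exp_sub_one_le (c := 1.102) ?_ (by positivity) (by linarith) (by linarith)
  nlinarith [mul_le_mul_of_nonneg_right h1 hu.le]

end SmallRoundoff

/-- The error level `λ (√m n u + √(n+1) n u)` of one run of CholeskyQR. -/
noncomputable def errorLevel (m n : ℕ) (u lam : ℝ) : ℝ :=
  lam * (√(m : ℝ) * n * u + √((n : ℝ) + 1) * n * u)

section Runs

variable {m n : ℕ} {u lam : ℝ} {A : Matrix (Fin m) (Fin n) ℝ} {G σ : ℝ}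

/-- The number `140800 = 64 * 2200` comes from multiplying the bound on the condition number by
the bound `x ≤ 1 / 2200`. -/
theorem mul_le_of_sq_mul_le {x s c d : ℝ} (hσ : 0 ≤ σ) (hx : 0 ≤ x)
    (hxs : x ≤ s) (hx1 : x ≤ 1 / 2200) (hs : 64 * s * G ^ 2 ≤ σ ^ 2) (hd : 0 ≤ d)
    (hcd : c ^ 2 ≤ 140800 * d ^ 2) : c * x * G ≤ d * σ := by
  refine abs_le_of_sq_le_sq' ?_ (by positivity) |>.2
  have h1 : 64 * x * G ^ 2 ≤ σ ^ 2 := by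
    refine le_trans ?_ hs
    gcongr
  have h2 : 140800 * (x ^ 2 * G ^ 2) ≤ σ ^ 2 := by
    have := mul_le_mul_of_nonneg_right hx1 (by positivity : 0 ≤ x * G ^ 2)
    nlinarith
  calc (c * x * G) ^ 2 = c ^ 2 * (x ^ 2 * G ^ 2) := by ring
    _ ≤ 140800 * d ^ 2 * (x ^ 2 * G ^ 2) := by gcongr
    _ = d ^ 2 * (140800 * (x ^ 2 * G ^ 2)) := by ring
    _ ≤ d ^ 2 * σ ^ 2 := by gcongr
    _ = (d * σ) ^ 2 := by ring

theorem SmallRoundoff.isWellConditioned (h : SmallRoundoff m n u lam) (hG : 0 ≤ G) (hσ : 0 < σ)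
    (hcol : ∀ j, colNorm A j ≤ G) (hle : ∀ x, σ * vnorm x ≤ vnorm (A.mulVec x))
    (hs : 64 * errorLevel m n u lam * G ^ 2 ≤ σ ^ 2) :
    IsWellConditioned A G σ (1.42 * (lam * √(m : ℝ) * u)) (1.61 * (lam * √((n : ℝ) + 1) * u)) := by
  have hu := h.u_pos
  have hl := h.lam_pos
  have hn := h.one_le_n_real
  have hx0 : 0 ≤ lam * √(m : ℝ) * u := by positivity
  have hy0 : 0 ≤ lam * √((n : ℝ) + 1) * u := by positivity
  have hx1 := mul_le_mul_of_nonneg_left hn hx0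
  have hy1 := mul_le_mul_of_nonneg_left hn hy0
  have hx2 := h.m_prob
  have hy2 := h.n_prob
  unfold errorLevel at hs
  refine ⟨hG, hσ, by positivity, by positivity, by linarith, by linarith, hcol, hle, ?_, ?_, ?_⟩
  · have h1 : n * ((1.42 * (lam * √(m : ℝ) * u) + 1.07 * (1.61 * (lam * √((n : ℝ) + 1) * u)))
        * G ^ 2) ≤ 1.73 * (lam * (√(m : ℝ) * n * u + √((n : ℝ) + 1) * n * u)) * G ^ 2 := by
      rw [← mul_assoc]
      refine mul_le_mul_of_nonneg_right ?_ (sq_nonneg G)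
      nlinarith
    nlinarith
  · have := mul_le_of_sq_mul_le (x := lam * √(m : ℝ) * n * u) (c := 1.42) (d := 0.005) hσ.le
      (by positivity) (by linarith) hx2 hs (by norm_num) (by norm_num)
    linarith
  · have := mul_le_of_sq_mul_le (x := lam * √((n : ℝ) + 1) * n * u) (c := 1.61) (d := 0.005)
      hσ.le (by positivity) (by linarith) hy2 hs (by norm_num) (by norm_num)
    linarith

theorem SmallRoundoff.sqrt_mul_le (h : SmallRoundoff m n u lam) :
    lam * √(n : ℝ) * n * u ≤ lam * √((n : ℝ) + 1) * n * u := by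
  have := h.lam_pos
  have := h.u_pos
  have : √(n : ℝ) ≤ √((n : ℝ) + 1) := Real.sqrt_le_sqrt (by linarith)
  gcongr

theorem SmallRoundoff.solve_le (h : SmallRoundoff m n u lam) (hσ : 0 < σ)
    (hs : 64 * errorLevel m n u lam * G ^ 2 ≤ σ ^ 2) :
    n * (1.11 * (lam * √(n : ℝ) * u)) * G ≤ 0.003 * σ := by
  have hu := h.u_pos
  have hl := h.lam_pos
  have hx0 : 0 ≤ lam * √(m : ℝ) * n * u := by positivity
  have h1 := h.sqrt_mul_le
  have hy2 := h.n_prob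
  unfold errorLevel at hs
  have := mul_le_of_sq_mul_le (x := lam * √(n : ℝ) * n * u) (c := 1.11) (d := 0.003)
    hσ.le (by positivity) (by linarith) (by linarith) hs (by norm_num) (by norm_num)
  linarith

end Runs

section TwoRuns

variable {m n : ℕ} {u lam : ℝ} {T Q Q₁ : Matrix (Fin m) (Fin n) ℝ}
  {V V₁ V₂ : Matrix (Fin n) (Fin n) ℝ}

/-- Orthogonality after the second run. Its input is nearly orthogonal, so `p` is close to `1`
and `p ^ 2` may appear as a factor of the bound. -/
theorem SmallRoundoff.frobNorm_orth_le (h : SmallRoundoff m n u lam) {G p : ℝ}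
    (hA : IsWellConditioned Q G 0.98 (1.42 * (lam * √(m : ℝ) * u))
      (1.61 * (lam * √((n : ℝ) + 1) * u)))
    (hV : IsPerturbedCholesky Q V₁ (1.42 * (lam * √(m : ℝ) * u))
      (1.61 * (lam * √((n : ℝ) + 1) * u)))
    (hQ : IsPerturbedSolve Q V₁ Q₁ (1.11 * (lam * √(n : ℝ) * u)))
    (hCG : n * (1.11 * (lam * √(n : ℝ) * u)) * G ≤ 0.003 * 0.98)
    (hspec : specNorm Q ≤ 1.02) (hG : G ≤ 1.02) (hp : 0.98 ≤ 1.02 * p) :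
    frobNorm (Q₁.transpose * Q₁ - 1) ≤ 6 * p ^ 2 * errorLevel m n u lam := by
  have hu := h.u_pos
  have hl := h.lam_pos
  have hG0 := hA.G_nonneg
  set a := lam * √(m : ℝ) * n * u with ha
  set b := lam * √((n : ℝ) + 1) * n * u with hb
  set c := lam * √(n : ℝ) * n * u with hc
  have hs_eq : errorLevel m n u lam = a + b := by rw [errorLevel, ha, hb]; ring
  have ha0 : 0 ≤ a := by positivity
  have hb0 : 0 ≤ b := by positivity
  have hb1 : b ≤ 1 / 2200 := h.n_prob
  have hGsq : G ^ 2 ≤ 1.0404 := by nlinarith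
  have h1 : 1.0221 * (n * (1.11 * (lam * √(n : ℝ) * u)) * G) ≤ 1.16 * b := by
    have h2 : n * (1.11 * (lam * √(n : ℝ) * u)) * G = 1.11 * (c * G) := by rw [hc]; ring
    rw [h2]
    have h3 : c * G ≤ b * 1.02 := mul_le_mul h.sqrt_mul_le hG hG0 hb0
    linarith
  have h2 := hQ.frobNorm_orth_le (by positivity) hV hA hCG h1 le_rfl hspec
  have h3 : n * ((1.42 * (lam * √(m : ℝ) * u) + 1.005 * (1.61 * (lam * √((n : ℝ) + 1) * u)))
      * G ^ 2) ≤ 1.69 * (a + b) := by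
    have h4 : n * ((1.42 * (lam * √(m : ℝ) * u) + 1.005 * (1.61 * (lam * √((n : ℝ) + 1) * u)))
      * G ^ 2) = (1.42 * a + 1.005 * 1.61 * b) * G ^ 2 := by rw [ha, hb]; ring
    have h5 := mul_le_mul_of_nonneg_left hGsq (by positivity : 0 ≤ 1.42 * a + 1.005 * 1.61 * b)
    rw [h4]
    linarith
  have h5 : 0.92 ≤ p ^ 2 := by nlinarith
  have h6 : 0.92 * (a + b) ≤ p ^ 2 * (a + b) := mul_le_mul_of_nonneg_right h5 (by positivity)
  have h7 : (1.16 * b) ^ 2 ≤ 0.001 * b := by nlinarith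
  rw [hs_eq]
  linarith

/-- The residual splits into the errors of the two solves and of the product `V₁ V`. -/
theorem frobNorm_residual_le (T Q Q₁ : Matrix (Fin m) (Fin n) ℝ)
    (V V₁ V₂ : Matrix (Fin n) (Fin n) ℝ) :
    frobNorm (Q₁ * V₂ - T) ≤ frobNorm (Q * V - T) + frobNorm (Q₁ * V₁ - Q) * specNorm V
      + specNorm Q₁ * frobNorm (V₂ - V₁ * V) := by
  have hsplit : Q₁ * V₂ - T = (Q * V - T) + (Q₁ * V₁ - Q) * V + Q₁ * (V₂ - V₁ * V) := by
    rw [Matrix.sub_mul, Matrix.mul_sub, Matrix.mul_assoc]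
    abel
  have h1 := frobNorm_add_le ((Q * V - T) + (Q₁ * V₁ - Q) * V) (Q₁ * (V₂ - V₁ * V))
  have h2 := frobNorm_add_le (Q * V - T) ((Q₁ * V₁ - Q) * V)
  have h3 := frobNorm_mul_le_mul_specNorm (Q₁ * V₁ - Q) V
  have h4 := frobNorm_mul_le_specNorm_mul Q₁ (V₂ - V₁ * V)
  rw [hsplit]
  linarith

/-- The terms of the residual, for `x = λ n √n u`, `S = ‖T‖₂`, `g = ‖T‖_g` and `G = ‖Q‖_g`. -/
theorem residual_le {x g p q S E₁ E₂ D vs qs G : ℝ} (hx : 0 ≤ x) (hg : g = q * S)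
    (hp : 0 ≤ p) (hq : 0 ≤ q) (hS : 0 ≤ S) (hG0 : 0 ≤ G) (hG : G ≤ 1.02 * p)
    (hvs0 : 0 ≤ vs) (hD0 : 0 ≤ D)
    (hE₁ : E₁ ≤ 1.0221 * (1.11 * (x * g))) (hE₂ : E₂ ≤ 1.0221 * (1.11 * (x * G)))
    (hvs : vs ≤ 1.015 * S) (hqs : qs ≤ 1.02) (hD : D ≤ 1.1145 * (x * (G * g))) :
    E₁ + E₂ * vs + qs * D ≤ (1.2 * q + 1.32 * p + 1.32 * q * p) * x * S := by
  have h1 : E₂ * vs ≤ 1.32 * (p * x * S) := by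
    calc _ ≤ 1.0221 * (1.11 * (x * G)) * (1.015 * S) := mul_le_mul hE₂ hvs hvs0 (by positivity)
      _ ≤ 1.0221 * (1.11 * (x * (1.02 * p))) * (1.015 * S) := by gcongr
      _ = 1.0221 * 1.11 * 1.02 * 1.015 * (p * x * S) := by ring
      _ ≤ 1.32 * (p * x * S) := mul_le_mul_of_nonneg_right (by norm_num) (by positivity)
  have h2 : qs * D ≤ 1.32 * (q * p * x * S) := by
    have hg0 : 0 ≤ g := hg ▸ mul_nonneg hq hS
    calc _ ≤ 1.02 * (1.1145 * (x * (G * g))) := mul_le_mul hqs hD hD0 (by norm_num)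
      _ ≤ 1.02 * (1.1145 * (x * (1.02 * p * g))) := by gcongr
      _ = 1.02 * 1.1145 * 1.02 * (q * p * x * S) := by rw [hg]; ring
      _ ≤ 1.32 * (q * p * x * S) := mul_le_mul_of_nonneg_right (by norm_num) (by positivity)
  have h3 : E₁ ≤ 1.2 * (q * x * S) := by
    rw [hg] at hE₁
    have : 0 ≤ q * x * S := by positivity
    linarith
  linarith

/-- One run of CholeskyQR for a well-conditioned matrix. -/
theorem SmallRoundoff.step (h : SmallRoundoff m n u lam) {A : Matrix (Fin m) (Fin n) ℝ} {σ : ℝ}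
    (hσ : 0 < σ) (hle : ∀ x, σ * vnorm x ≤ vnorm (A.mulVec x))
    (hs : 64 * errorLevel m n u lam * gNorm A ^ 2 ≤ σ ^ 2) {e : StepOp m n → ℝ}
    (he : ErrorsBounded u (lam * √((m : ℝ) - 1) * u) (lam * √((n : ℝ) - 1) * u) e) :
    StepCompletes A e ∧
    IsWellConditioned A (gNorm A) σ (1.42 * (lam * √(m : ℝ) * u))
      (1.61 * (lam * √((n : ℝ) + 1) * u)) ∧
    IsPerturbedCholesky A (stepV A e) (1.42 * (lam * √(m : ℝ) * u))
      (1.61 * (lam * √((n : ℝ) + 1) * u)) ∧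
    IsPerturbedSolve A (stepV A e) (stepQ A e) (1.11 * (lam * √(n : ℝ) * u)) ∧
    n * (1.11 * (lam * √(n : ℝ) * u)) * gNorm A ≤ 0.003 * σ := by
  have hu := h.u_pos
  have hl := h.lam_pos
  have hu2 : u ≤ 1 / 2 := by linarith [h.u_le]
  have hA := h.isWellConditioned (gNorm_nonneg A) hσ (colNorm_le_gNorm A) hle hs
  have hV := he.isPerturbedCholesky (A := A) hu.le hu2 (by positivity) (by positivity)
    h.exp_gram_le h.exp_chol_le
  exact ⟨stepCompletes_of_diag_pos fun j => hV.diag_pos hA j, hA, hV,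
    he.isPerturbedSolve hu2 (by positivity) h.exp_solve_le fun j => (hV.diag_pos hA j).ne',
    h.solve_le hσ hs⟩

/-- CholeskyQR2 for a well-conditioned matrix: both runs are completed, and the errors are small.
In terms of `‖T‖_g` and the singular value `σ`, the bound on the condition number reads
`64 s ‖T‖_g² ≤ σ²`, where `s` is the error level. -/
theorem SmallRoundoff.cholQR2_bounds (h : SmallRoundoff m n u lam) {σ : ℝ}
    (hσ : 0 < σ) (hle : ∀ x, σ * vnorm x ≤ vnorm (T.mulVec x))
    (hs : 64 * errorLevel m n u lam * gNorm T ^ 2 ≤ σ ^ 2) {e : Op m n → ℝ}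
    (h₁ : ErrorsBounded u (lam * √((m : ℝ) - 1) * u) (lam * √((n : ℝ) - 1) * u)
      fun o => e (.first o))
    (h₂ : ErrorsBounded u (lam * √((m : ℝ) - 1) * u) (lam * √((n : ℝ) - 1) * u)
      fun o => e (.second o))
    (hmul : ∀ i j k, |e (.prodMul i j k)| ≤ u) (hadd : ∀ i j k, |e (.prodAdd i j k)| ≤ u)
    (hprod : ∀ i j (r : Fin n), |∑ l with r ≤ l ∧ 0 < l.val, e (.prodAdd i j l)|
      ≤ lam * √((n : ℝ) - 1) * u) :
    FirstCompletes T e ∧ 1 / √(n : ℝ) ≤ gRatio (outQ T e) ∧ gRatio (outQ T e) ≤ 1 ∧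
      SecondCompletes T e ∧
      frobNorm ((outQ1 T e).transpose * outQ1 T e - 1)
        ≤ 6 * gRatio (outQ T e) ^ 2 * errorLevel m n u lam ∧
      frobNorm (outQ1 T e * outV2 T e - T)
        ≤ (1.2 * gRatio T + 1.32 * gRatio (outQ T e) + 1.32 * gRatio T * gRatio (outQ T e))
          * (lam * (n * √(n : ℝ)) * u) * specNorm T := by
  have hu := h.u_pos
  have hu2 : u ≤ 1 / 2 := by linarith [h.u_le]
  have hl := h.lam_pos
  have hC : 0 ≤ 1.11 * (lam * √(n : ℝ) * u) := by positivity
  obtain ⟨hfirst, hA₁, hV₁, hQ₁, hCG₁⟩ := h.step hσ hle hs h₁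
  have hQb : ∀ y, 0.98 * vnorm y ≤ vnorm ((outQ T e).mulVec y) ∧
      vnorm ((outQ T e).mulVec y) ≤ 1.02 * vnorm y := hQ₁.vnorm_mulVec_bounds hC hV₁ hA₁ hCG₁
  have hspec : specNorm (outQ T e) ≤ 1.02 := specNorm_le (by norm_num) fun x => (hQb x).2
  have hG0 := gNorm_nonneg (outQ T e)
  have hG1 : gNorm (outQ T e) ≤ 1.02 := (gNorm_le_specNorm h.one_le_n _).trans hspec
  have hG2 : 0.98 ≤ gNorm (outQ T e) := by
    have h1 := (hQb (Pi.single ⟨0, h.one_le_n⟩ 1)).1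
    rw [vnorm_single, ← colNorm_eq_vnorm_mulVec] at h1
    linarith [colNorm_le_gNorm (outQ T e) ⟨0, h.one_le_n⟩]
  have hspec0 : 0 < specNorm (outQ T e) := by
    linarith [gNorm_le_specNorm h.one_le_n (outQ T e)]
  obtain ⟨hp1, hp2⟩ := gRatio_mem_Icc h.one_le_n hspec0
  have hpG : gNorm (outQ T e) = gRatio (outQ T e) * specNorm (outQ T e) := by
    rw [gRatio, div_mul_cancel₀ _ hspec0.ne']
  have hp0 : 0 ≤ gRatio (outQ T e) := div_nonneg hG0 hspec0.le
  have hGp : gNorm (outQ T e) ≤ 1.02 * gRatio (outQ T e) := by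
    rw [hpG, mul_comm]
    exact mul_le_mul_of_nonneg_right hspec hp0
  have hs₂ : 64 * errorLevel m n u lam * gNorm (outQ T e) ^ 2 ≤ 0.98 ^ 2 := by
    have h1 : gNorm (outQ T e) ^ 2 ≤ 1.02 ^ 2 := pow_le_pow_left₀ hG0 hG1 2
    have h2 : errorLevel m n u lam ≤ 1 / 1100 := by
      rw [errorLevel]
      linarith [h.m_prob, h.n_prob]
    have h3 := mul_le_mul h2 h1 (sq_nonneg _) (by norm_num)
    linarith
  obtain ⟨hsecond, hA₂, hV₂, hQ₂, hCG₂⟩ :=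
    h.step (σ := 0.98) (by norm_num) (fun x => (hQb x).1) hs₂ h₂
  refine ⟨hfirst, hp1, hp2, hsecond, h.frobNorm_orth_le hA₂ hV₂ hQ₂ hCG₂ hspec hG1
    (hG2.trans hGp), ?_⟩
  have hE₁ := hQ₁.frobNorm_err_le hC hV₁ hA₁ hCG₁
  have hE₂ := hQ₂.frobNorm_err_le hC hV₂ hA₂ hCG₂
  have hTpos : 0 < specNorm T := by
    have h1 := hle (Pi.single ⟨0, h.one_le_n⟩ 1)
    have h2 := vnorm_mulVec_le T (Pi.single ⟨0, h.one_le_n⟩ 1)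
    rw [vnorm_single] at h1 h2
    linarith
  have hVs : specNorm (outV T e) ≤ 1.015 * specNorm T := specNorm_le (by positivity) fun z => by
    have h1 : vnorm ((outV T e).mulVec z) ≤ _ := (hV₁.vnorm_mulVec_bounds hA₁ z).2.2
    have h2 := vnorm_mulVec_le T z
    linarith
  have hQ₁s : specNorm (outQ1 T e) ≤ 1.02 := specNorm_le (by norm_num)
    fun y => (hQ₂.vnorm_mulVec_bounds hC hV₂ hA₂ hCG₂ y).2
  have hD : frobNorm (outV2 T e - outV1 T e * outV T e)
      ≤ 1.1145 * (lam * (n * √(n : ℝ)) * u * (gNorm (outQ T e) * gNorm T)) := by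
    have h3 : √(n : ℝ) * √n = n := Real.mul_self_sqrt (Nat.cast_nonneg n)
    have h4 : frobNorm (outV T e) ≤ _ := hV₁.frobNorm_le hA₁
    have h5 : frobNorm (outV1 T e) ≤ _ := hV₂.frobNorm_le hA₂
    have h6 := frobNorm_nonneg (outV T e)
    have h7 := gNorm_nonneg T
    calc _ ≤ 1.11 * (lam * √(n : ℝ) * u) * (frobNorm (outV1 T e) * frobNorm (outV T e)) :=
          frobNorm_le_of_abs_le_sum hC fun i j =>
            abs_flMul_sub_le hu2 hmul hadd hprod h.exp_solve_le i j
      _ ≤ 1.11 * (lam * √(n : ℝ) * u)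
          * (√n * (1.002 * gNorm (outQ T e)) * (√n * (1.002 * gNorm T))) := by gcongr
      _ = 1.11 * 1.002 * 1.002
          * (lam * ((√(n : ℝ) * √n) * √n) * u * (gNorm (outQ T e) * gNorm T)) := by ring
      _ ≤ _ := by
          rw [h3]
          exact mul_le_mul_of_nonneg_right (by norm_num) (by positivity)
  have hxc : ∀ y, n * (1.11 * (lam * √(n : ℝ) * u)) * y
      = 1.11 * (lam * (n * √(n : ℝ)) * u * y) := fun y => by ring
  rw [hxc] at hE₁ hE₂
  exact (frobNorm_residual_le T (outQ T e) (outQ1 T e) (outV T e) (outV1 T e) (outV2 T e)).trans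
    (residual_le (by positivity) (by rw [gRatio, div_mul_cancel₀ _ hTpos.ne']) hp0
      (div_nonneg (gNorm_nonneg T) hTpos.le) hTpos.le hG0 hGp (specNorm_nonneg _)
      (frobNorm_nonneg _) hE₁ hE₂ hVs hQ₁s hD)

end TwoRuns

/-! ### Probability of small accumulated errors -/

section Probability

variable {Ω : Type*} [mΩ : MeasurableSpace Ω] {μ : Measure Ω} [IsProbabilityMeasure μ]
  {ι : Type*} {ξ : ι → Ω → ℝ} {u lam : ℝ}

/-- Hoeffding's inequality for the sum of the errors with labels in `S`. -/
theorem measureReal_lt_abs_sum_le (hmeas : ∀ o, Measurable (ξ o)) (hindep : iIndepFun ξ μ)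
    (hmean : ∀ o, ∫ ω, ξ o ω ∂μ = 0) (hbound : ∀ o, ∀ᵐ ω ∂μ, |ξ o ω| ≤ u)
    (hu0 : 0 < u) (hu1 : u ≤ 1) (hlam : 0 ≤ lam) (S : Finset ι) {L : ℝ} (hL : S.card ≤ L) :
    μ.real {ω | lam * √L * u < |∑ o ∈ S, ξ o ω|} ≤ 1 - probP u lam := by
  set ε := lam * √L * u with hε
  have hε0 : 0 ≤ ε := by positivity
  rcases S.eq_empty_or_nonempty with rfl | hS
  · have : {ω | ε < |∑ o ∈ (∅ : Finset ι), ξ o ω|} = ∅ := by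
      ext ω
      simpa using hε0
    rw [this, probP]
    simp [Real.exp_nonneg]
  have hcard : (0 : ℝ) < S.card := by exact_mod_cast hS.card_pos
  have hsub : ∀ o ∈ S, HasSubgaussianMGF (ξ o) ((‖u - -u‖₊ / 2) ^ 2) μ := fun o _ =>
    hasSubgaussianMGF_of_mem_Icc_of_integral_eq_zero (hmeas o).aemeasurable
      (by filter_upwards [hbound o] with ω h using abs_le.1 h) (hmean o)
  have hpar : ((∑ _o ∈ S, (‖u - -u‖₊ / 2) ^ 2 : NNReal) : ℝ) = S.card * u ^ 2 := by
    push_cast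
    rw [Finset.sum_const, nsmul_eq_mul, Real.norm_of_nonneg (by linarith)]
    ring
  have hexp : Real.exp (-ε ^ 2 / (2 * ((∑ _o ∈ S, (‖u - -u‖₊ / 2) ^ 2 : NNReal) : ℝ)))
      ≤ Real.exp (-(lam ^ 2 * (1 - u) ^ 2 / 2)) := by
    rw [Real.exp_le_exp, hpar, neg_div, neg_le_neg_iff, hε, mul_pow, mul_pow,
      Real.sq_sqrt (hcard.le.trans hL), div_le_div_iff₀ two_pos (by positivity)]
    have h1 : (1 - u) ^ 2 ≤ 1 := by nlinarith
    have h2 : (1 - u) ^ 2 * S.card ≤ 1 * L := mul_le_mul h1 hL hcard.le zero_le_one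
    nlinarith [mul_le_mul_of_nonneg_left h2 (by positivity : 0 ≤ 2 * lam ^ 2 * u ^ 2)]
  have h1 := (HasSubgaussianMGF.sum_of_iIndepFun hindep hsub).measure_ge_le hε0
  have h2 := (HasSubgaussianMGF.sum_of_iIndepFun hindep hsub).neg.measure_ge_le hε0
  have hcover : {ω | ε < |∑ o ∈ S, ξ o ω|}
      ⊆ {ω | ε ≤ ∑ o ∈ S, ξ o ω} ∪ {ω | ε ≤ (-fun ω => ∑ o ∈ S, ξ o ω) ω} := by
    intro ω hω
    rcases lt_abs.1 (show ε < |∑ o ∈ S, ξ o ω| from hω) with h | h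
    · exact Or.inl h.le
    · exact Or.inr h.le
  have h3 := (measureReal_mono (μ := μ) hcover).trans (measureReal_union_le _ _)
  rw [probP]
  linarith

/-- The event that, for every `c`, the errors with labels in `C c` have a sum of modulus at most
`λ √(L c) u`. -/
def smallSums {K : Type*} (ξ : ι → Ω → ℝ) (u lam : ℝ) (C : K → Finset ι) (L : K → ℝ) : Set Ω :=
  {ω | ∀ c, |∑ o ∈ C c, ξ o ω| ≤ lam * √(L c) * u}

theorem measurableSet_smallSums_of_measurable {α : Type*} {mα : MeasurableSpace α} {ξ : ι → α → ℝ}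
    {K : Type*} [Countable K] {C : K → Finset ι} (L : K → ℝ)
    (h : ∀ c, ∀ o ∈ C c, Measurable (ξ o)) : MeasurableSet (smallSums ξ u lam C L) := by
  rw [smallSums, Set.ofPred_forall]
  exact MeasurableSet.iInter fun c =>
    measurableSet_le (Finset.measurable_fun_sum _ (h c)).abs measurable_const

theorem measurableSet_smallSums {α : Type*} {ξ : ι → α → ℝ} {K : Type*} [Countable K] (C : K → Finset ι) (L : K → ℝ)
    {S : Set ι} (hC : ∀ c, ∀ o ∈ C c, o ∈ S) :
    MeasurableSet[⨆ o ∈ S, MeasurableSpace.comap (ξ o) inferInstance]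
      (smallSums ξ u lam C L) :=
  measurableSet_smallSums_of_measurable L fun c o ho =>
    (comap_measurable (ξ o)).mono (le_iSup₂_of_le o (hC c o ho) le_rfl) le_rfl

theorem probP_le_one : probP u lam ≤ 1 := by
  rw [probP]
  linarith [Real.exp_nonneg (-(lam ^ 2 * (1 - u) ^ 2 / 2))]

theorem probQ_le_measureReal_smallSums (hmeas : ∀ o, Measurable (ξ o)) (hindep : iIndepFun ξ μ)
    (hmean : ∀ o, ∫ ω, ξ o ω ∂μ = 0) (hbound : ∀ o, ∀ᵐ ω ∂μ, |ξ o ω| ≤ u)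
    (hu0 : 0 < u) (hu1 : u ≤ 1) (hlam : 0 ≤ lam) {K : Type*} [Fintype K] (C : K → Finset ι)
    (L : K → ℝ) (hL : ∀ c, (C c).card ≤ L c) {N : ℝ} (hN : Fintype.card K ≤ N) :
    probQ u lam N ≤ μ.real (smallSums ξ u lam C L) := by
  have hms : MeasurableSet (smallSums ξ u lam C L) :=
    measurableSet_smallSums_of_measurable L fun _ o _ => hmeas o
  have h1 : (smallSums ξ u lam C L)ᶜ = ⋃ c, {ω | lam * √(L c) * u < |∑ o ∈ C c, ξ o ω|} := by
    ext ω
    simp [smallSums]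
  have h2 : μ.real (smallSums ξ u lam C L)ᶜ ≤ Fintype.card K * (1 - probP u lam) := by
    rw [h1]
    refine (measureReal_iUnion_fintype_le _).trans ?_
    refine (Finset.sum_le_card_nsmul _ _ (1 - probP u lam) fun c _ =>
      measureReal_lt_abs_sum_le hmeas hindep hmean hbound hu0 hu1 hlam (C c) (hL c)).trans ?_
    rw [nsmul_eq_mul, Finset.card_univ]
  rw [probReal_compl_eq_one_sub hms] at h2
  have h3 := mul_le_mul_of_nonneg_right hN (sub_nonneg.2 (probP_le_one (u := u) (lam := lam)))
  rw [probQ]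
  linarith

/-- Events that depend on disjoint groups of errors are independent. -/
theorem measureReal_biInter_eq_prod {γ : Type*} [DecidableEq γ] (hmeas : ∀ o, Measurable (ξ o))
    (hindep : iIndepFun ξ μ) (grp : ι → γ) (A : γ → Set Ω)
    (hA : ∀ g, MeasurableSet[⨆ o ∈ {o | grp o = g}, MeasurableSpace.comap (ξ o) inferInstance]
      (A g)) (s : Finset γ) :
    μ.real (⋂ g ∈ s, A g) = ∏ g ∈ s, μ.real (A g) := by
  induction s using Finset.induction_on with
  | empty => simp
  | insert g s hg ih =>
    have h1 : Indep (⨆ o ∈ {o | grp o = g}, MeasurableSpace.comap (ξ o) inferInstance)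
        (⨆ o ∈ {o | grp o ∈ s}, MeasurableSpace.comap (ξ o) inferInstance) μ := by
      refine indep_iSup_of_disjoint (fun o => (hmeas o).comap_le) hindep ?_
      rw [Set.disjoint_left]
      rintro o rfl ho
      exact hg ho
    have h2 : MeasurableSet[⨆ o ∈ {o | grp o ∈ s}, MeasurableSpace.comap (ξ o) inferInstance]
        (⋂ g ∈ s, A g) := by
      refine Finset.measurableSet_biInter s fun g' hg' => ?_
      have hle : ⨆ o ∈ {o | grp o = g'}, MeasurableSpace.comap (ξ o) inferInstance
          ≤ ⨆ o ∈ {o | grp o ∈ s}, MeasurableSpace.comap (ξ o) inferInstance :=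
        iSup₂_le fun o ho =>
          le_iSup₂_of_le o (show grp o ∈ s from (show grp o = g' from ho) ▸ hg') le_rfl
      exact hle _ (hA g')
    rw [Finset.set_biInter_insert, Finset.prod_insert hg, ← ih, measureReal_def,
      (Indep_iff _ _ μ).1 h1 _ _ (hA g) h2, ENNReal.toReal_mul]
    rfl

end Probability

/-! ### The groups of rounding errors in CholeskyQR2 -/

section Chains

variable {m n : ℕ}

/-- The stage of CholeskyQR2 in which an error occurs, as far as sums of errors matter: the Gram
matrix and the triangular solves of a run (`0` and `2`), its Cholesky factorization (`1` and `3`),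
and the final product (`4`). -/
def opGroup : Op m n → Fin 5
  | .first (.cholSub _ _ _) => 1
  | .first _ => 0
  | .second (.cholSub _ _ _) => 3
  | .second _ => 2
  | .prodMul _ _ _ => 4
  | .prodAdd _ _ _ => 4

theorem first_injective : Function.Injective (Op.first : StepOp m n → Op m n) :=
  fun _ _ h => by injection h

theorem second_injective : Function.Injective (Op.second : StepOp m n → Op m n) :=
  fun _ _ h => by injection h

variable {f : StepOp m n → Op m n} (hf : Function.Injective f)

/-- The sums of errors that matter in the Gram matrix and in the triangular solves of one run. A
triple `(i, j, r)` with `i ≤ j` stands for the product number `r` in the entry `(i, j)` of the Gram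
matrix, one with `j < i` for the subtractions up to number `j` in the solve for the entry `(r, i)`.
In this way `n * n * m` sums account for both. -/
def gramSolveSums (c : Fin n × Fin n × Fin m) : Finset (Op m n) :=
  if c.1 ≤ c.2.1 then
    (Finset.univ.filter fun l : Fin m => c.2.2 ≤ l ∧ 0 < l.val).map
      ⟨fun l => f (.gramAdd c.1 c.2.1 l), fun _ _ h => by injection hf h⟩
  else
    (Finset.univ.filter fun l : Fin n => l ≤ c.2.1).map
      ⟨fun l => f (.solveSub c.2.2 c.1 l), fun _ _ h => by injection hf h⟩

/-- Bound for the number of terms in `gramSolveSums`. -/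
noncomputable def gramSolveLength (c : Fin n × Fin n × Fin m) : ℝ :=
  if c.1 ≤ c.2.1 then (m : ℝ) - 1 else (n : ℝ) - 1

/-- The sums of errors that matter in the Cholesky factorization: `⟨j, i, k⟩` with `k < i ≤ j`
stands for the subtractions up to number `k` in the entry `(i, j)`. -/
def cholSums (c : Σ j : Fin n, Σ i : Fin (j.val + 1), Fin i.val) : Finset (Op m n) :=
  (Finset.univ.filter fun l : Fin n => l.val ≤ c.2.2.val).map
    ⟨fun l => f (.cholSub (Fin.castLE c.1.isLt c.2.1) c.1 l), fun _ _ h => by injection hf h⟩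

/-- The sums of errors that matter in the product of the triangular factors. -/
def prodSums (c : Fin n × Fin n × Fin n) : Finset (Op m n) :=
  (Finset.univ.filter fun l : Fin n => c.2.2 ≤ l ∧ 0 < l.val).map
    ⟨fun l => .prodAdd c.1 c.2.1 l, fun _ _ h => by injection h⟩

theorem card_filter_pos_le {k : ℕ} (r : Fin k) :
    ((Finset.univ.filter fun l : Fin k => r ≤ l ∧ 0 < l.val).card : ℝ) ≤ (k : ℝ) - 1 := by
  have h0 : 0 < k := r.pos
  have h1 : (Finset.univ.filter fun l : Fin k => r ≤ l ∧ 0 < l.val)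
      ⊆ Finset.univ.erase ⟨0, h0⟩ := by
    intro l hl
    have := (Finset.mem_filter.1 hl).2.2
    refine Finset.mem_erase.2 ⟨?_, Finset.mem_univ _⟩
    rintro rfl
    exact lt_irrefl _ this
  have h2 := Finset.card_le_card h1
  rw [Finset.card_erase_of_mem (Finset.mem_univ _), Finset.card_fin] at h2
  rw [le_sub_iff_add_le]
  exact_mod_cast (by omega : _ + 1 ≤ k)

theorem card_filter_le_le {k i : ℕ} (hi : i < n) (hk : k < i) :
    ((Finset.univ.filter fun l : Fin n => l.val ≤ k).card : ℝ) ≤ (n : ℝ) - 1 := by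
  have h0 : 0 < n := by omega
  have h1 : (Finset.univ.filter fun l : Fin n => l.val ≤ k)
      ⊆ Finset.univ.erase ⟨i, hi⟩ := by
    intro l hl
    have := (Finset.mem_filter.1 hl).2
    refine Finset.mem_erase.2 ⟨?_, Finset.mem_univ _⟩
    rintro rfl
    exact hk.not_ge this
  have h2 := Finset.card_le_card h1
  rw [Finset.card_erase_of_mem (Finset.mem_univ _), Finset.card_fin] at h2
  rw [le_sub_iff_add_le]
  exact_mod_cast (by omega : _ + 1 ≤ n)

theorem card_gramSolveSums_le (c : Fin n × Fin n × Fin m) :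
    ((gramSolveSums hf c).card : ℝ) ≤ gramSolveLength c := by
  rw [gramSolveSums, gramSolveLength]
  split_ifs with h
  · rw [Finset.card_map]
    exact card_filter_pos_le c.2.2
  · rw [Finset.card_map]
    exact card_filter_le_le c.1.isLt (not_le.1 h)

theorem card_cholSums_le (c : Σ j : Fin n, Σ i : Fin (j.val + 1), Fin i.val) :
    ((cholSums hf c).card : ℝ) ≤ (n : ℝ) - 1 := by
  rw [cholSums, Finset.card_map]
  exact card_filter_le_le (Nat.lt_of_lt_of_le c.2.1.isLt c.1.isLt) c.2.2.isLt

theorem card_prodSums_le (c : Fin n × Fin n × Fin n) :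
    ((prodSums (m := m) c).card : ℝ) ≤ (n : ℝ) - 1 := by
  rw [prodSums, Finset.card_map]
  exact card_filter_pos_le c.2.2

theorem six_mul_sum_sum_range (n : ℕ) :
    6 * ∑ j ∈ Finset.range n, ∑ i ∈ Finset.range (j + 1), i + n = n ^ 3 := by
  induction n with
  | zero => simp
  | succ n ih =>
    have h := Finset.sum_range_id_mul_two (n + 1)
    rw [Nat.add_sub_cancel] at h
    rw [Finset.sum_range_succ, mul_add]
    nlinarith

theorem card_cholSums_index_le : (Fintype.card (Σ j : Fin n, Σ i : Fin (j.val + 1), Fin i.val) : ℝ)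
    ≤ (n : ℝ) ^ 3 / 6 + (n : ℝ) ^ 2 / 2 + (n : ℝ) / 3 := by
  have h1 : Fintype.card (Σ j : Fin n, Σ i : Fin (j.val + 1), Fin i.val)
      = ∑ j ∈ Finset.range n, ∑ i ∈ Finset.range (j + 1), i := by
    simp only [Fintype.card_sigma, Fintype.card_fin]
    rw [← Fin.sum_univ_eq_sum_range (fun j => ∑ i ∈ Finset.range (j + 1), i) n]
    exact Finset.sum_congr rfl fun j _ => Fin.sum_univ_eq_sum_range (fun i => i) (j.val + 1)
  have h2 : (6 * (∑ j ∈ Finset.range n, ∑ i ∈ Finset.range (j + 1), i : ℕ) + n : ℝ)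
      = (n : ℝ) ^ 3 := by exact_mod_cast six_mul_sum_sum_range n
  rw [h1]
  nlinarith [sq_nonneg (n : ℝ), (Nat.cast_nonneg n : (0 : ℝ) ≤ n)]

theorem opGroup_of_mem_gramSolveSums_first {c : Fin n × Fin n × Fin m} {o : Op m n}
    (ho : o ∈ gramSolveSums first_injective c) : opGroup o = 0 := by
  rw [gramSolveSums] at ho
  split_ifs at ho <;> obtain ⟨l, -, rfl⟩ := Finset.mem_map.1 ho <;> rfl

theorem opGroup_of_mem_gramSolveSums_second {c : Fin n × Fin n × Fin m} {o : Op m n}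
    (ho : o ∈ gramSolveSums second_injective c) : opGroup o = 2 := by
  rw [gramSolveSums] at ho
  split_ifs at ho <;> obtain ⟨l, -, rfl⟩ := Finset.mem_map.1 ho <;> rfl

variable {Ω : Type*} {ξ : Op m n → Ω → ℝ} {u lam : ℝ} {ω : Ω}

theorem errorsBounded_of_mem_smallSums (hu : ∀ o, |ξ o ω| ≤ u)
    (h1 : ω ∈ smallSums ξ u lam (gramSolveSums hf) gramSolveLength)
    (h2 : ω ∈ smallSums ξ u lam (cholSums hf) fun _ => (n : ℝ) - 1) :
    ErrorsBounded u (lam * √((m : ℝ) - 1) * u) (lam * √((n : ℝ) - 1) * u)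
      fun o => ξ (f o) ω where
  bound o := hu _
  gram i j hij r := by
    have h := h1 (i, j, r)
    simp only [gramSolveSums, gramSolveLength, if_pos hij, Finset.sum_map] at h
    exact h
  chol i j hij k hk := by
    have h := h2 ⟨j, ⟨i.val, Nat.lt_succ_of_le hij⟩, ⟨k.val, hk⟩⟩
    simp only [cholSums, Finset.sum_map] at h
    exact h
  solve i j k hk := by
    have h := h1 (j, k, i)
    simp only [gramSolveSums, gramSolveLength, if_neg (not_le.2 hk), Finset.sum_map] at h
    exact h

theorem abs_sum_prodAdd_le
    (h : ω ∈ smallSums ξ u lam (prodSums (m := m)) fun _ => (n : ℝ) - 1) (i j r : Fin n) :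
    |∑ l with r ≤ l ∧ 0 < l.val, ξ (.prodAdd i j l) ω| ≤ lam * √((n : ℝ) - 1) * u := by
  have h := h (i, j, r)
  simp only [prodSums, Finset.sum_map] at h
  exact h

end Chains

section Countable

variable {m n : ℕ}

instance : Countable (StepOp m n) :=
  Function.Injective.countable (β := ℕ × ℕ × ℕ × ℕ)
    (f := fun o => match o with
      | .gramMul i j k => (0, i, j, k)
      | .gramAdd i j k => (1, i, j, k)
      | .cholMul i j k => (2, i, j, k)
      | .cholSub i j k => (3, i, j, k)
      | .cholFin i j => (4, i, j, 0)
      | .solveMul i j k => (5, i, j, k)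
      | .solveSub i j k => (6, i, j, k)
      | .solveDiv i j => (7, i, j, 0))
    fun a b h => by cases a <;> cases b <;> simp_all [Fin.ext_iff]

instance : Countable (Op m n) :=
  Function.Injective.countable
    (β := (StepOp m n ⊕ StepOp m n) ⊕ (Fin n × Fin n × Fin n) ⊕ (Fin n × Fin n × Fin n))
    (f := fun o => match o with
      | .first o => .inl (.inl o)
      | .second o => .inl (.inr o)
      | .prodMul i j k => .inr (.inl (i, j, k))
      | .prodAdd i j k => .inr (.inr (i, j, k)))
    fun a b h => by cases a <;> cases b <;> simp_all

end Countable

section Parameters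

variable {m n : ℕ} {u lam : ℝ}

theorem mul_log_two_lt {N : ℝ} (hu0 : 0 < u) (hu1 : u ≤ 1) (hQ : 0 < probQ u lam N) (k : ℕ)
    (hk : 2 ^ k ≤ 2 * N) : k * Real.log 2 < lam ^ 2 / 2 := by
  rw [probQ, probP] at hQ
  have h1 : (1 - u) ^ 2 ≤ 1 := by nlinarith
  have h2 : lam ^ 2 * (1 - u) ^ 2 / 2 ≤ lam ^ 2 / 2 := by
    nlinarith [mul_le_mul_of_nonneg_left h1 (sq_nonneg lam)]
  have h3 := Real.exp_le_exp.2 (neg_le_neg h2)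
  have h5 : (0 : ℝ) < 2 ^ k := by positivity
  have h4 := mul_le_mul hk h3 (Real.exp_pos _).le (h5.le.trans hk)
  have h6 : Real.exp (k * Real.log 2 - lam ^ 2 / 2) < 1 := by
    rw [sub_eq_add_neg, Real.exp_add, Real.exp_nat_mul, Real.exp_log two_pos]
    linarith
  linarith [Real.exp_lt_one_iff.1 h6]

theorem probQ_antitone {N N' : ℝ} (h : N ≤ N') : probQ u lam N' ≤ probQ u lam N := by
  rw [probQ, probQ]
  have := mul_le_mul_of_nonneg_right h (sub_nonneg.2 (probP_le_one (u := u) (lam := lam)))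
  linarith

theorem probQ_le_one {N : ℝ} (hN : 0 ≤ N) : probQ u lam N ≤ 1 := by
  simpa [probQ] using probQ_antitone (u := u) (lam := lam) hN

theorem smallRoundoff_of_probQ_pos (hm : n ≤ m) (hn : 0 < n) (hu : 0 < u) (hlam : 0 < lam)
    (hm_small : max (lam * √(m : ℝ) * n * u) (m * n * u) ≤ 1 / 2200)
    (hn_small : max (lam * √((n : ℝ) + 1) * n * u) (((n : ℝ) + 1) * n * u) ≤ 1 / 2200)
    (hQ : 0 < probQ u lam ((m : ℝ) * (n : ℝ) ^ 2)) : SmallRoundoff m n u lam := by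
  have hn1 : (1 : ℝ) ≤ n := by exact_mod_cast hn
  have hmn : (n : ℝ) ≤ m := by exact_mod_cast hm
  have hu1 : u ≤ 1 := by
    have h1 := (max_le_iff.1 hn_small).2
    nlinarith
  have hlog := Real.log_two_gt_d9
  refine ⟨hu, hn.trans_le hm, hn, ?_, fun h2 => ?_, (max_le_iff.1 hm_small).1,
    (max_le_iff.1 hm_small).2, (max_le_iff.1 hn_small).1, (max_le_iff.1 hn_small).2⟩
  · have h1 : (1 : ℝ) ≤ m * (n : ℝ) ^ 2 := one_le_mul_of_one_le_of_one_le (hn1.trans hmn)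
      (one_le_pow₀ hn1)
    have h2 := mul_log_two_lt hu hu1 hQ 1 (by linarith)
    push_cast at h2
    nlinarith
  · have h3 : (2 : ℝ) ≤ n := by exact_mod_cast h2
    have h1 : (2 : ℝ) * 2 ^ 2 ≤ m * (n : ℝ) ^ 2 :=
      mul_le_mul (h3.trans hmn) (pow_le_pow_left₀ zero_le_two h3 2) (by positivity) (by positivity)
    have h2 := mul_log_two_lt hu hu1 hQ 4 (by linarith)
    push_cast at h2
    nlinarith

theorem sq_mul_errorLevel_le {T : Matrix (Fin m) (Fin n) ℝ} (hσ : 0 < sigmaMin T)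
    (hT : 0 < specNorm T) (hs : 0 ≤ errorLevel m n u lam)
    (hδ : 8 * gRatio T * kappa2 T * √(errorLevel m n u lam) ≤ 1) :
    64 * errorLevel m n u lam * gNorm T ^ 2 ≤ sigmaMin T ^ 2 := by
  have h1 : 8 * gRatio T * kappa2 T * √(errorLevel m n u lam)
      = 8 * gNorm T * √(errorLevel m n u lam) / sigmaMin T := by
    rw [gRatio, kappa2]
    field_simp
  rw [h1, div_le_one hσ] at hδ
  have hG := gNorm_nonneg T
  have h2 := pow_le_pow_left₀ (by positivity) hδ 2
  rw [mul_pow, Real.sq_sqrt hs] at h2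
  linarith

end Parameters

end CholQR

theorem theorem3p1 {Ω : Type*} [MeasurableSpace Ω] (μ : Measure Ω) [IsProbabilityMeasure μ]
    {m n : ℕ} (hn : 0 < n)
    (T : Matrix (Fin m) (Fin n) ℝ) (hT : T.rank = n)
    (u lam : ℝ) (hu : 0 < u) (hlam : 0 < lam)
    (hm_small : max (lam * √(m : ℝ) * n * u) (m * n * u) ≤ 1 / 2200)
    (hn_small : max (lam * √((n : ℝ) + 1) * n * u) (((n : ℝ) + 1) * n * u) ≤ 1 / 2200)
    (hQ : 0 < CholQR.probQ u lam ((m : ℝ) * (n : ℝ) ^ 2))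
    -- the relative errors of the elementary operations
    (ξ : CholQR.Op m n → Ω → ℝ)
    (hξ_meas : ∀ o, Measurable (ξ o))
    (hξ_indep : iIndepFun ξ μ)
    (hξ_mean : ∀ o, ∫ ω, ξ o ω ∂μ = 0)
    (hξ_bound : ∀ o, ∀ᵐ ω ∂μ, |ξ o ω| ≤ u)
    (hδ₁ : 8 * CholQR.gRatio T * CholQR.kappa2 T
      * √(lam * (√(m : ℝ) * n * u + √((n : ℝ) + 1) * n * u)) ≤ 1) :
    (1 / √(n : ℝ) ≤ CholQR.gRatio T ∧ CholQR.gRatio T ≤ 1) ∧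
    (CholQR.probQ u lam ((m : ℝ) * (n : ℝ) ^ 2)
        * CholQR.probQ u lam ((n : ℝ) ^ 3 / 6 + (n : ℝ) ^ 2 / 2 + (n : ℝ) / 3)
        * CholQR.probQ u lam ((n : ℝ) * ((n : ℝ) + 1) / 2)) ^ 2
      * CholQR.probQ u lam ((n : ℝ) ^ 3)
    ≤ μ.real {ω |
        let e : CholQR.Op m n → ℝ := fun o => ξ o ω
        let p₁ : ℝ := CholQR.gRatio T
        let p₂ : ℝ := CholQR.gRatio (CholQR.outQ T e)
        CholQR.FirstCompletes T e ∧ 1 / √(n : ℝ) ≤ p₂ ∧ p₂ ≤ 1 ∧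
        (8 * p₂ * CholQR.kappa2 T
            * √(lam * (√(m : ℝ) * n * u + √((n : ℝ) + 1) * n * u)) ≤ 1 →
          CholQR.SecondCompletes T e ∧
          CholQR.frobNorm ((CholQR.outQ1 T e).transpose * CholQR.outQ1 T e - 1)
            ≤ 6 * lam * p₂ ^ 2 * (√(m : ℝ) * n * u + √((n : ℝ) + 1) * n * u) ∧
          CholQR.frobNorm (CholQR.outQ1 T e * CholQR.outV2 T e - T)
            ≤ (1.2 * p₁ + 1.32 * p₂ + 1.32 * p₁ * p₂) * lam * (n * √(n : ℝ)) * u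
              * CholQR.specNorm T)} := by
  have hmn : n ≤ m := by simpa [hT] using T.rank_le_card_height
  have h := CholQR.smallRoundoff_of_probQ_pos hmn hn hu hlam hm_small hn_small hQ
  have hn1 := h.one_le_n_real
  have hmn' : (n : ℝ) ≤ m := by exact_mod_cast hmn
  have hu1 : u ≤ 1 := by linarith [h.u_le]
  have hσ := CholQR.sigmaMin_pos hn hT
  have hle := CholQR.sigmaMin_mul_vnorm_le hn T
  have hTpos : 0 < CholQR.specNorm T := by
    have h1 := hle (Pi.single ⟨0, hn⟩ 1)
    have h2 := CholQR.vnorm_mulVec_le T (Pi.single ⟨0, hn⟩ 1)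
    rw [CholQR.vnorm_single] at h1 h2
    linarith
  have hs := CholQR.sq_mul_errorLevel_le (u := u) (lam := lam) hσ hTpos
    (by rw [CholQR.errorLevel]; positivity) hδ₁
  refine ⟨CholQR.gRatio_mem_Icc hn hTpos, ?_⟩
  -- The events for the five groups of errors.
  set E : Fin 5 → Set Ω := ![
    CholQR.smallSums ξ u lam (CholQR.gramSolveSums CholQR.first_injective) CholQR.gramSolveLength,
    CholQR.smallSums ξ u lam (CholQR.cholSums CholQR.first_injective) fun _ => (n : ℝ) - 1,
    CholQR.smallSums ξ u lam (CholQR.gramSolveSums CholQR.second_injective) CholQR.gramSolveLength,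
    CholQR.smallSums ξ u lam (CholQR.cholSums CholQR.second_injective) fun _ => (n : ℝ) - 1,
    CholQR.smallSums ξ u lam CholQR.prodSums fun _ => (n : ℝ) - 1] with hE
  have hEmeas : ∀ g, MeasurableSet[⨆ o ∈ {o | CholQR.opGroup o = g},
      MeasurableSpace.comap (ξ o) inferInstance] (E g) := by
    intro g
    fin_cases g
    · exact CholQR.measurableSet_smallSums _ _ fun c o ho =>
        CholQR.opGroup_of_mem_gramSolveSums_first ho
    · refine CholQR.measurableSet_smallSums _ _ fun c o ho => ?_
      obtain ⟨l, -, rfl⟩ := Finset.mem_map.1 ho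
      rfl
    · exact CholQR.measurableSet_smallSums _ _ fun c o ho =>
        CholQR.opGroup_of_mem_gramSolveSums_second ho
    · refine CholQR.measurableSet_smallSums _ _ fun c o ho => ?_
      obtain ⟨l, -, rfl⟩ := Finset.mem_map.1 ho
      rfl
    · refine CholQR.measurableSet_smallSums _ _ fun c o ho => ?_
      obtain ⟨l, -, rfl⟩ := Finset.mem_map.1 ho
      rfl
  have hprod := CholQR.measureReal_biInter_eq_prod hξ_meas hξ_indep CholQR.opGroup E hEmeas
    Finset.univ
  have hsub : (⋂ g ∈ Finset.univ, E g : Set Ω) ≤ᵐ[μ] {ω |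
        let e : CholQR.Op m n → ℝ := fun o => ξ o ω
        let p₁ : ℝ := CholQR.gRatio T
        let p₂ : ℝ := CholQR.gRatio (CholQR.outQ T e)
        CholQR.FirstCompletes T e ∧ 1 / √(n : ℝ) ≤ p₂ ∧ p₂ ≤ 1 ∧
        (8 * p₂ * CholQR.kappa2 T
            * √(lam * (√(m : ℝ) * n * u + √((n : ℝ) + 1) * n * u)) ≤ 1 →
          CholQR.SecondCompletes T e ∧
          CholQR.frobNorm ((CholQR.outQ1 T e).transpose * CholQR.outQ1 T e - 1)
            ≤ 6 * lam * p₂ ^ 2 * (√(m : ℝ) * n * u + √((n : ℝ) + 1) * n * u) ∧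
          CholQR.frobNorm (CholQR.outQ1 T e * CholQR.outV2 T e - T)
            ≤ (1.2 * p₁ + 1.32 * p₂ + 1.32 * p₁ * p₂) * lam * (n * √(n : ℝ)) * u
              * CholQR.specNorm T)} := by
    filter_upwards [ae_all_iff.2 hξ_bound] with ω hω hmem
    have hmem : ∀ g, ω ∈ E g := fun g => Set.mem_iInter₂.1 hmem g (Finset.mem_univ g)
    obtain ⟨h1, h2, h3, h4, h5, h6⟩ := h.cholQR2_bounds (e := fun o => ξ o ω) hσ hle hs
      (CholQR.errorsBounded_of_mem_smallSums CholQR.first_injective hω (hmem 0) (hmem 1))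
      (CholQR.errorsBounded_of_mem_smallSums CholQR.second_injective hω (hmem 2) (hmem 3))
      (fun _ _ _ => hω _) (fun _ _ _ => hω _) (CholQR.abs_sum_prodAdd_le (hmem 4))
    refine ⟨h1, h2, h3, fun _ => ⟨h4, h5.trans (le_of_eq ?_), h6.trans (le_of_eq ?_)⟩⟩
    · rw [CholQR.errorLevel]
      ring
    · ring
  refine le_trans ?_ (ENNReal.toReal_mono (measure_ne_top _ _) (measure_mono_ae hsub))
  rw [← measureReal_def, hprod]
  have hmono := fun (K : Type) (_ : Fintype K) (C : K → Finset (CholQR.Op m n)) =>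
    CholQR.probQ_le_measureReal_smallSums hξ_meas hξ_indep hξ_mean hξ_bound hu hu1 hlam.le C
  have hcard : (Fintype.card (Fin n × Fin n × Fin m) : ℝ) ≤ (m : ℝ) * (n : ℝ) ^ 2 := by
    simp only [Fintype.card_prod, Fintype.card_fin]
    push_cast
    exact le_of_eq (by ring)
  have hcard' : (Fintype.card (Fin n × Fin n × Fin n) : ℝ) ≤ (n : ℝ) ^ 3 := by
    simp only [Fintype.card_prod, Fintype.card_fin]
    push_cast
    exact le_of_eq (by ring)
  have h0 : _ ≤ μ.real (E 0) := hmono _ _ _ _ (CholQR.card_gramSolveSums_le _) hcard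
  have h1 : _ ≤ μ.real (E 1) :=
    hmono _ _ _ _ (CholQR.card_cholSums_le _) CholQR.card_cholSums_index_le
  have h2 : _ ≤ μ.real (E 2) := hmono _ _ _ _ (CholQR.card_gramSolveSums_le _) hcard
  have h3 : _ ≤ μ.real (E 3) :=
    hmono _ _ _ _ (CholQR.card_cholSums_le _) CholQR.card_cholSums_index_le
  have h4 : _ ≤ μ.real (E 4) := hmono _ _ _ _ CholQR.card_prodSums_le hcard'
  have hN : (n : ℝ) ^ 3 ≤ (m : ℝ) * (n : ℝ) ^ 2 := by
    nlinarith [mul_le_mul_of_nonneg_right hmn' (sq_nonneg (n : ℝ))]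
  have hq1 := hQ.le.trans (CholQR.probQ_antitone (u := u) (lam := lam)
    (N := (n : ℝ) ^ 3 / 6 + (n : ℝ) ^ 2 / 2 + (n : ℝ) / 3) (by nlinarith))
  have hq2 := hQ.le.trans (CholQR.probQ_antitone (u := u) (lam := lam)
    (N := (n : ℝ) * ((n : ℝ) + 1) / 2) (by nlinarith))
  have hq2' := CholQR.probQ_le_one (u := u) (lam := lam)
    (N := (n : ℝ) * ((n : ℝ) + 1) / 2) (by positivity)
  have hq4 := hQ.le.trans (CholQR.probQ_antitone (u := u) (lam := lam) hN)
  have hq0 := hQ.le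
  set q0 := CholQR.probQ u lam ((m : ℝ) * (n : ℝ) ^ 2)
  set q1 := CholQR.probQ u lam ((n : ℝ) ^ 3 / 6 + (n : ℝ) ^ 2 / 2 + (n : ℝ) / 3)
  set q2 := CholQR.probQ u lam ((n : ℝ) * ((n : ℝ) + 1) / 2)
  set q4 := CholQR.probQ u lam ((n : ℝ) ^ 3)
  calc (q0 * q1 * q2) ^ 2 * q4 ≤ (q0 * q1 * 1) ^ 2 * q4 := by gcongr
    _ = q0 * q1 * q0 * q1 * q4 := by ring
    _ ≤ μ.real (E 0) * μ.real (E 1) * μ.real (E 2) * μ.real (E 3) * μ.real (E 4) := by gcongr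
    _ = ∏ g, μ.real (E g) := by rw [Fin.prod_univ_five]
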